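/- Let $a>0$, $q_{\mathrm{FP}}\in(0,1)$ and $\epsilon_{\mathrm{HWa}}>0$, and set $$b:=\min\Big\{\tfrac18,\tfrac a4,\tfrac{q_{\mathrm{FP}}}4\Big\},\qquad \epsilon_{\mathcal B}:=\min\Big\{\frac{\epsilon_{\mathrm{HWa}}}{2b},\frac1{2b},1\Big\}.$$ For $0<\epsilon<\epsilon_{\mathcal B}$ let $c_\epsilon:=(1+\epsilon^2/24)^{1/2}$, $q_\epsilon:=b\epsilon$ and $\delta_\epsilon:=b\epsilon/2$. For $q\in\mathbb R$ and $r\in\{0,1,2,\dots\}$ let $W_q^{r,\infty}$ be the space of all $f\in L^1_{\mathrm{loc}}(\mathbb R,\mathbb C)$ with $e^{-q\cdot}f\in W^{r,\infty}(\mathbb R,\mathbb C)$, with the norm $\|f\|_{W_q^{r,\infty}}:=\|e^{-q\cdot}f\|_{W^{r,\infty}}=\sum_{j=0}^r\|\partial_x^j(e^{-q\cdot}f)\|_{L^\infty}$, and let $L_q^\infty:=W_q^{0,\infty}$. Let $(S^df)(x):=f(x+d)$ and $$\mathcal B_cf:=c^2f''+2f+S^1f+S^{-1}f,\qquad \widetilde{\mathcal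 B}_c(z):=-c^2z^2+2+2\cos z .$$ For $g\in L_q^\infty$ let $\mathfrak L_+[g](z):=\int_0^\infty g(s)e^{-sz}\,ds$ for $\operatorname{Re}z>q$ and $\mathfrak L_-[g](z):=\int_0^\infty g(-s)e^{sz}\,ds$ for $\operatorname{Re}z<q$. Then for every $0<\epsilon<\epsilon_{\mathcal B}$ and for both $q=-q_\epsilon$ and $q=q_\epsilon$, the operator $\mathcal B_{c_\epsilon}$ is a bounded linear bijection from $W_q^{2,\infty}$ onto $L_q^\infty$ with bounded inverse. Write $[\mathcal B_{c_\epsilon}^{-}]^{-1}$ for the inverse when $q=-q_\epsilon$ and $[\mathcal B_{c_\epsilon}^{+}]^{-1}$ for the inverse when $q=q_\epsilon$. For $g\in L^\infty_{\pm q_\epsilon}$ and almost every $x\in\mathbb R$, $$\big([\mathcal B_{c_\epsilon}^{\pm}]^{-1}g\big)(x)=\frac1{2\pi i}\int_{\pm q_\epsilon+\delta_\epsilon-i\infty}^{\pm q_\epsilon+\delta_\epsilon+i\infty}\frac{e^{xz}}{\widetilde{\mathcal B}_{c_\epsilon}(iz)}\,\mathfrak L_+[g](z)\,dz+\frac1{2\pi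 i}\int_{\pm q_\epsilon-\delta_\epsilon-i\infty}^{\pm q_\epsilon-\delta_\epsilon+i\infty}\frac{e^{xz}}{\widetilde{\mathcal B}_{c_\epsilon}(iz)}\,\mathfrak L_-[g](z)\,dz ,$$ where both integrals converge absolutely for every $x\in\mathbb R$. Moreover, there is a constant $C>0$, depending only on $a$, $q_{\mathrm{FP}}$ and $\epsilon_{\mathrm{HWa}}$, such that for all $0<\epsilon<\epsilon_{\mathcal B}$ $$\big\|[\mathcal B_{c_\epsilon}^{\pm}]^{-1}\big\|_{L_{\pm q_\epsilon}^\infty\to W_{\pm q_\epsilon}^{2,\infty}}\le C\epsilon^{-1}.$$ -/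

import Mathlib

open MeasureTheory
open scoped ENNReal ContDiff

noncomputable section

namespace AdvanceDelay

/-! ### Weak derivatives -/

/-- `v` is the `k`-th weak (distributional) derivative of `u` on the real line. -/
def IsWeakDeriv (k : ℕ) (u v : ℝ → ℂ) : Prop :=
  LocallyIntegrable u ∧ LocallyIntegrable v ∧
    ∀ φ : ℝ → ℝ, ContDiff ℝ ∞ φ → HasCompactSupport φ →
      ∫ x, iteratedDeriv k φ x • u x = (-1) ^ k * ∫ x, φ x • v x

theorem IsWeakDeriv.congr {k : ℕ} {u v u' v' : ℝ → ℂ} (h : IsWeakDeriv k u v)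
    (hu : u =ᵐ[volume] u') (hv : v =ᵐ[volume] v') : IsWeakDeriv k u' v' := by
  refine ⟨h.1.congr hu, h.2.1.congr hv, fun φ hφ hs => ?_⟩
  have e1 : ∫ x, iteratedDeriv k φ x • u' x = ∫ x, iteratedDeriv k φ x • u x :=
    integral_congr_ae (hu.mono fun x hx => by simp only [hx])
  have e2 : ∫ x, φ x • v' x = ∫ x, φ x • v x :=
    integral_congr_ae (hv.mono fun x hx => by simp only [hx])
  rw [e1, e2, h.2.2 φ hφ hs]

theorem hasCompactSupport_iteratedDeriv {φ : ℝ → ℝ} (hs : HasCompactSupport φ) (k : ℕ) :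
    HasCompactSupport (iteratedDeriv k φ) := by
  induction k with
  | zero => simpa using hs
  | succ k ih => rw [iteratedDeriv_succ]; exact ih.deriv

theorem integrable_iteratedDeriv_smul {φ : ℝ → ℝ} (hφ : ContDiff ℝ ∞ φ)
    (hs : HasCompactSupport φ) (k : ℕ) {u : ℝ → ℂ} (hu : LocallyIntegrable u) :
    Integrable fun x => iteratedDeriv k φ x • u x :=
  hu.integrable_smul_left_of_hasCompactSupport
    (hφ.continuous_iteratedDeriv k (mod_cast le_top)) (hasCompactSupport_iteratedDeriv hs k)

theorem integrable_test_smul {φ : ℝ → ℝ} (hφ : ContDiff ℝ ∞ φ)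
    (hs : HasCompactSupport φ) {u : ℝ → ℂ} (hu : LocallyIntegrable u) :
    Integrable fun x => φ x • u x :=
  hu.integrable_smul_left_of_hasCompactSupport hφ.continuous hs

theorem IsWeakDeriv.add {k : ℕ} {u v u' v' : ℝ → ℂ} (h : IsWeakDeriv k u v)
    (h' : IsWeakDeriv k u' v') : IsWeakDeriv k (u + u') (v + v') := by
  refine ⟨h.1.add h'.1, h.2.1.add h'.2.1, fun φ hφ hs => ?_⟩
  simp only [Pi.add_apply, smul_add]
  rw [integral_add (integrable_iteratedDeriv_smul hφ hs k h.1)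
      (integrable_iteratedDeriv_smul hφ hs k h'.1),
    integral_add (integrable_test_smul hφ hs h.2.1) (integrable_test_smul hφ hs h'.2.1),
    h.2.2 φ hφ hs, h'.2.2 φ hφ hs, mul_add]

theorem IsWeakDeriv.const_smul {k : ℕ} {u v : ℝ → ℂ} (h : IsWeakDeriv k u v) (a : ℂ) :
    IsWeakDeriv k (a • u) (a • v) := by
  refine ⟨h.1.smul a, h.2.1.smul a, fun φ hφ hs => ?_⟩
  simp only [Pi.smul_apply, smul_comm _ a]
  rw [integral_smul, integral_smul, h.2.2 φ hφ hs, smul_eq_mul, smul_eq_mul]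
  ring

theorem isWeakDeriv_zero (k : ℕ) : IsWeakDeriv k (0 : ℝ → ℂ) 0 :=
  ⟨locallyIntegrable_zero, locallyIntegrable_zero, fun φ _ _ => by simp⟩

theorem IsWeakDeriv.unique {k : ℕ} {u v w : ℝ → ℂ} (h : IsWeakDeriv k u v)
    (h' : IsWeakDeriv k u w) : v =ᵐ[volume] w := by
  refine ae_eq_of_integral_contDiff_smul_eq h.2.1 h'.2.1 fun φ hφ hs => ?_
  have := (h.2.2 φ hφ hs).symm.trans (h'.2.2 φ hφ hs)
  exact mul_left_cancel₀ (pow_ne_zero _ (by norm_num)) this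

/-! ### One-sided exponentially weighted spaces -/

/-- The function `e^{-q x} f(x)`. -/
def weighted (q : ℝ) (f : ℝ → ℂ) : ℝ → ℂ :=
  fun x => Complex.exp (-(q * x : ℝ)) * f x

/-- The space `W_q^{r,∞}` of (almost everywhere classes of) locally integrable functions
`f : ℝ → ℂ` such that `e^{-q x} f(x)` lies in `W^{r,∞}`: all of its weak derivatives of order
at most `r` exist and are essentially bounded. -/
def WInf (q : ℝ) (r : ℕ) : Submodule ℂ (ℝ →ₘ[volume] ℂ) where
  carrier := {f | LocallyIntegrable f ∧
    ∀ j : Fin (r + 1), ∃ v : Lp ℂ ∞ (volume : Measure ℝ), IsWeakDeriv j (weighted q f) v}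
  zero_mem' := by
    have h0 : ((0 : ℝ →ₘ[volume] ℂ) : ℝ → ℂ) =ᵐ[volume] 0 := AEEqFun.coeFn_zero
    refine ⟨LocallyIntegrable.congr locallyIntegrable_zero h0.symm, fun j => ⟨0, ?_⟩⟩
    refine (isWeakDeriv_zero j).congr ?_ (Lp.coeFn_zero ℂ ∞ volume).symm
    filter_upwards [h0] with x hx
    simp [weighted, hx]
  add_mem' := by
    intro f g hf hg
    have h0 := AEEqFun.coeFn_add f g
    refine ⟨(hf.1.add hg.1).congr h0.symm, fun j => ?_⟩
    obtain ⟨v, hv⟩ := hf.2 j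
    obtain ⟨w, hw⟩ := hg.2 j
    refine ⟨v + w, (hv.add hw).congr ?_ (Lp.coeFn_add v w).symm⟩
    filter_upwards [h0] with x hx
    simp [weighted, hx, mul_add]
  smul_mem' := by
    intro a f hf
    have h0 := AEEqFun.coeFn_smul a f
    refine ⟨(hf.1.smul a).congr h0.symm, fun j => ?_⟩
    obtain ⟨v, hv⟩ := hf.2 j
    refine ⟨a • v, (hv.const_smul a).congr ?_ (Lp.coeFn_smul a v).symm⟩
    filter_upwards [h0] with x hx
    simp only [weighted, hx, Pi.smul_apply, smul_eq_mul]
    ring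

/-- The space `L_q^∞ = W_q^{0,∞}`. -/
abbrev LInf (q : ℝ) : Submodule ℂ (ℝ →ₘ[volume] ℂ) := WInf q 0

variable {q : ℝ} {r : ℕ}

/-- The `j`-th weak derivative of `e^{-q x} f(x)`, as an element of `L^∞`. -/
def wderiv (f : WInf q r) (j : Fin (r + 1)) : Lp ℂ ∞ (volume : Measure ℝ) :=
  (f.2.2 j).choose

theorem wderiv_spec (f : WInf q r) (j : Fin (r + 1)) :
    IsWeakDeriv j (weighted q (f : ℝ →ₘ[volume] ℂ)) (wderiv f j) :=
  (f.2.2 j).choose_spec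

theorem wderiv_eq (f : WInf q r) (j : Fin (r + 1)) {v : Lp ℂ ∞ (volume : Measure ℝ)}
    (hv : IsWeakDeriv j (weighted q (f : ℝ →ₘ[volume] ℂ)) v) : wderiv f j = v :=
  Lp.ext ((wderiv_spec f j).unique hv)

theorem wderiv_add (f g : WInf q r) (j : Fin (r + 1)) :
    wderiv (f + g) j = wderiv f j + wderiv g j := by
  refine wderiv_eq _ _ (((wderiv_spec f j).add (wderiv_spec g j)).congr ?_
    (Lp.coeFn_add _ _).symm)
  filter_upwards [AEEqFun.coeFn_add (f : ℝ →ₘ[volume] ℂ) g] with x hx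
  simp [weighted, hx, mul_add]

theorem wderiv_smul (a : ℂ) (f : WInf q r) (j : Fin (r + 1)) :
    wderiv (a • f) j = a • wderiv f j := by
  refine wderiv_eq _ _ (((wderiv_spec f j).const_smul a).congr ?_ (Lp.coeFn_smul _ _).symm)
  filter_upwards [AEEqFun.coeFn_smul a (f : ℝ →ₘ[volume] ℂ)] with x hx
  simp only [weighted, Submodule.coe_smul, hx, Pi.smul_apply, smul_eq_mul]
  ring

theorem eq_zero_of_wderiv_zero (f : WInf q r) (h : wderiv f 0 = 0) : f = 0 := by
  have h1 := wderiv_spec f 0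
  have h2 : IsWeakDeriv 0 (weighted q (f : ℝ →ₘ[volume] ℂ)) (weighted q f) :=
    ⟨h1.1, h1.1, fun φ _ _ => by simp⟩
  have h3 := h2.unique h1
  rw [h] at h3
  apply Subtype.ext
  apply AEEqFun.ext
  filter_upwards [h3, Lp.coeFn_zero ℂ ∞ (volume : Measure ℝ),
    AEEqFun.coeFn_zero (α := ℝ) (β := ℂ) (μ := volume)] with x h3 h4 h5
  rw [h4] at h3
  simp only [weighted, Pi.zero_apply, mul_eq_zero, Complex.exp_ne_zero, false_or] at h3
  simp only [Submodule.coe_zero, h5, Pi.zero_apply, h3]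

/-- `‖f‖_{W_q^{r,∞}} = ‖e^{-q·} f‖_{W^{r,∞}}`, the sum of the `L^∞` norms of the weak
derivatives of order at most `r` of `e^{-q x} f(x)`. -/
instance : NormedAddCommGroup (WInf q r) :=
  AddGroupNorm.toNormedAddCommGroup
    { toFun := fun f => ∑ j, ‖wderiv f j‖
      map_zero' := by
        refine Finset.sum_eq_zero fun j _ => ?_
        have := wderiv_smul (0 : ℂ) (0 : WInf q r) j
        rw [zero_smul, zero_smul] at this
        rw [this, norm_zero]
      add_le' := fun f g => by
        rw [← Finset.sum_add_distrib]
        refine Finset.sum_le_sum fun j _ => ?_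
        rw [wderiv_add]
        exact norm_add_le _ _
      neg' := fun f => by
        refine Finset.sum_congr rfl fun j _ => ?_
        have := wderiv_smul (-1 : ℂ) f j
        rw [neg_one_smul ℂ f, neg_one_smul ℂ (wderiv f j)] at this
        rw [this, norm_neg]
      eq_zero_of_map_eq_zero' := fun f h => by
        have := (Finset.sum_eq_zero_iff_of_nonneg fun j _ => norm_nonneg (wderiv f j)).1 h 0
          (Finset.mem_univ _)
        exact eq_zero_of_wderiv_zero f (norm_eq_zero.1 this) }

theorem norm_def (f : WInf q r) : ‖f‖ = ∑ j, ‖wderiv f j‖ := rfl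

instance : NormedSpace ℂ (WInf q r) where
  norm_smul_le a f := by
    rw [norm_def, norm_def, Finset.mul_sum]
    refine Finset.sum_le_sum fun j _ => ?_
    rw [wderiv_smul, norm_smul]

/-! ### The operator `B_c` -/

/-- The shift `(S^d f)(x) = f(x + d)`. -/
def shift (d : ℝ) (f : ℝ →ₘ[volume] ℂ) : ℝ →ₘ[volume] ℂ :=
  f.compMeasurePreserving (fun x => x + d) (measurePreserving_add_right volume d)

/-- `f` has a weak second derivative and `B_c f = c² f'' + 2 f + S¹ f + S⁻¹ f` equals `g`. -/
def IsBImage (c : ℝ) (f g : ℝ →ₘ[volume] ℂ) : Prop :=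
  ∃ f₂ : ℝ →ₘ[volume] ℂ, IsWeakDeriv 2 f f₂ ∧
    g = ((c : ℂ) ^ 2) • f₂ + (2 : ℂ) • f + shift 1 f + shift (-1) f

/-- The symbol of `B_c`. -/
def symbolB (c : ℝ) (z : ℂ) : ℂ := -(c : ℂ) ^ 2 * z ^ 2 + 2 + 2 * Complex.cos z

/-! ### Laplace transforms and contour integrals -/

/-- `∫_0^∞ f(s) e^{-sz} ds`. -/
def laplacePlus (f : ℝ → ℂ) (z : ℂ) : ℂ :=
  ∫ s in Set.Ioi (0 : ℝ), f s * Complex.exp (-(s * z))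

/-- `∫_0^∞ f(-s) e^{sz} ds`. -/
def laplaceMinus (f : ℝ → ℂ) (z : ℂ) : ℂ :=
  ∫ s in Set.Ioi (0 : ℝ), f (-s) * Complex.exp (s * z)

/-- The point `σ + it` of the vertical line `Re z = σ`. -/
def vline (σ t : ℝ) : ℂ := σ + t * Complex.I

/-- `(1 / 2πi) ∫_{σ - i∞}^{σ + i∞} F(z) dz`, with `z = σ + it`, `dz = i dt`. -/
def contourIntegral (σ : ℝ) (F : ℂ → ℂ) : ℂ :=
  1 / (2 * Real.pi * Complex.I) * ∫ t : ℝ, F (vline σ t) * Complex.I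

/-- The kernel `e^{xz} / B̃_c(iz)`. -/
def kernelK (c x : ℝ) (z : ℂ) : ℂ := Complex.exp (x * z) / symbolB c (Complex.I * z)

/-! ### Parameters -/

/-- The wave speed `c_ε`. -/
def waveSpeed (ε : ℝ) : ℝ := Real.sqrt (1 + ε ^ 2 / 24)

/-- The constant `b = min {1/8, a/4, q_FP/4}`. -/
def rateB (a qFP : ℝ) : ℝ := min (1 / 8) (min (a / 4) (qFP / 4))

/-- The threshold `ε_B = min {ε_HWa/(2b), 1/(2b), 1}`. -/
def epsB (a qFP εHWa : ℝ) : ℝ :=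
  min (εHWa / (2 * rateB a qFP)) (min (1 / (2 * rateB a qFP)) 1)

end AdvanceDelay

end

open AdvanceDelay

/-!
`B_c` is inverted on the space of weight `q` by convolution with the Green's function `green c q`,
the inverse bilateral Laplace transform of `1 / (c² z² + 2 + 2 cosh z)` along `Re z = q`. In the
strip `|Re z| ≤ 1/4` the denominator vanishes only at one conjugate pair of simple imaginary zeros,
so the contour may be moved freely within each of the half strips `0 < ± Re z ≤ 1/4`.

The `ε⁻¹` in the norm bound comes from a bound `‖green c q y‖ ≤ A e^{q y - |q| |y|}` with `A`
independent of `c` and `q`. For `y` of the sign opposite to `q` it follows by moving the contour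
away from the axis. For the other sign the contour has to cross the axis; the jump is estimated by
pairing the integrands at `± s + i t` for small `s`: since the denominators there are complex
conjugate, the difference is controlled by a Poisson kernel of width of order `s` around the
imaginary zeros, whose integral does not depend on `s`. Convolution with such a Green's function
costs a factor `∫ e^{-|q| |y|} dy = 2 / |q|`.

For uniqueness, the decay of the kernel lets `B_c` be moved onto the solution of the adjoint
equation whose right-hand side is an arbitrary test function. In the contour formula, by Fubini's
theorem, `ℒ₊` and `ℒ₋` produce the parts of the convolution integral over `s > 0` and `s < 0`.
-/

noncomputable section

namespace AdvanceDelay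

open Filter Topology ComplexConjugate

/-! ### The characteristic function on vertical lines -/

/-- The characteristic function `c² z² + 2 + 2 cosh z`: the eigenvalue of `B_c` on the exponential
`x ↦ e^{zx}`, that is, the symbol of `B_c` rotated from the Fourier to the Laplace variable. -/
def charFun (c : ℝ) (z : ℂ) : ℂ := (c : ℂ) ^ 2 * z ^ 2 + 2 + 2 * Complex.cosh z

/-- The factor `c z - 2 i cosh (z / 2)` of the characteristic function, the other factor being its
reflection in the real axis. -/
def charFactor (c : ℝ) (z : ℂ) : ℂ := c * z - 2 * Complex.I * Complex.cosh (z / 2)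

/-- The imaginary part of `charFactor c` at `σ + i t`. For `σ = 0` its zero is the frequency of the
bounded exponential solutions of `B_c f = 0`. -/
def charPhase (c σ t : ℝ) : ℝ := c * t - 2 * Real.cosh (σ / 2) * Real.cos (t / 2)

/-- A kernel of Poisson type, which as `σ → 0` concentrates at the zero of `charPhase c 0`. -/
def charPoisson (c σ t : ℝ) : ℝ := |σ| / ((|σ| / 20) ^ 2 + charPhase c σ t ^ 2)

theorem symbolB_I_mul (c : ℝ) (z : ℂ) : symbolB c (Complex.I * z) = charFun c z := by
  rw [symbolB, charFun, mul_comm Complex.I z, Complex.cos_mul_I, mul_pow, Complex.I_sq]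
  ring

theorem continuous_charFun (c : ℝ) : Continuous (charFun c) := by
  unfold charFun; fun_prop

theorem charFun_neg (c : ℝ) (z : ℂ) : charFun c (-z) = charFun c z := by
  simp [charFun]

theorem charFun_conj (c : ℝ) (z : ℂ) : charFun c (conj z) = conj (charFun c z) := by
  simp [charFun, Complex.cosh_conj, Complex.conj_ofNat]

theorem charFun_eq_mul_conj (c : ℝ) (z : ℂ) :
    charFun c z = charFactor c z * conj (charFactor c (conj z)) := by
  have cosh_eq : Complex.cosh z = 2 * Complex.cosh (z / 2) ^ 2 - 1 := by
    have h := Complex.cosh_two_mul (z / 2)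
    rw [Complex.sinh_sq, mul_div_cancel₀ z two_ne_zero] at h
    rw [h]; ring
  have conj_eq : conj (charFactor c (conj z)) = c * z + 2 * Complex.I * Complex.cosh (z / 2) := by
    simp [charFactor, ← Complex.cosh_conj, Complex.conj_ofNat]
  rw [conj_eq, charFun, charFactor, cosh_eq]
  linear_combination (4 * Complex.cosh (z / 2) ^ 2) * Complex.I_sq

@[simp] theorem vline_re (σ t : ℝ) : (vline σ t).re = σ := by simp [vline]

@[simp] theorem vline_im (σ t : ℝ) : (vline σ t).im = t := by simp [vline]

theorem vline_re_im (z : ℂ) : vline z.re z.im = z := Complex.re_add_im z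

theorem continuous_vline (σ : ℝ) : Continuous (vline σ) := by
  unfold vline; fun_prop

theorem conj_vline (σ t : ℝ) : conj (vline σ t) = vline σ (-t) := by
  apply Complex.ext <;> simp

theorem neg_vline (σ t : ℝ) : -vline σ t = vline (-σ) (-t) := by
  apply Complex.ext <;> simp

theorem charFun_vline_neg_left (c σ t : ℝ) :
    charFun c (vline (-σ) t) = conj (charFun c (vline σ t)) := by
  rw [← charFun_conj, conj_vline, ← charFun_neg, neg_vline, neg_neg]

theorem charFun_vline_im (c σ t : ℝ) :
    (charFun c (vline σ t)).im = 2 * c ^ 2 * σ * t + 2 * (Real.sinh σ * Real.sin t) := by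
  have cosh_eq : Complex.cosh (vline σ t) =
      (Real.cosh σ * Real.cos t : ℝ) + (Real.sinh σ * Real.sin t : ℝ) * Complex.I := by
    rw [vline, Complex.cosh_add, Complex.cosh_mul_I, Complex.sinh_mul_I]
    push_cast
    ring
  rw [charFun, cosh_eq]
  simp [sq, Complex.sinh_ofReal_re, Complex.sin_ofReal_re]
  ring

theorem charFactor_vline (c σ t : ℝ) : charFactor c (vline σ t) =
    (c * σ + 2 * (Real.sinh (σ / 2) * Real.sin (t / 2)) : ℝ) + charPhase c σ t * Complex.I := by
  have half_eq : vline σ t / 2 = (σ / 2 : ℝ) + (t / 2 : ℝ) * Complex.I := by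
    rw [vline]; push_cast; ring
  rw [charFactor, half_eq, Complex.cosh_add, Complex.cosh_mul_I, Complex.sinh_mul_I, vline,
    charPhase]
  push_cast
  linear_combination (-2 * Complex.sinh (σ / 2) * Complex.sin (t / 2)) * Complex.I_sq

theorem charFactor_vline_re (c σ t : ℝ) : (charFactor c (vline σ t)).re =
    c * σ + 2 * (Real.sinh (σ / 2) * Real.sin (t / 2)) := by
  rw [charFactor_vline, Complex.add_re, Complex.ofReal_re, Complex.re_ofReal_mul, Complex.I_re,
    mul_zero, add_zero]

theorem charFactor_vline_im (c σ t : ℝ) : (charFactor c (vline σ t)).im = charPhase c σ t := by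
  rw [charFactor_vline, Complex.add_im, Complex.ofReal_im, Complex.im_ofReal_mul, Complex.I_im,
    mul_one, zero_add]

theorem norm_charFun_vline (c σ t : ℝ) : ‖charFun c (vline σ t)‖ =
    ‖charFactor c (vline σ |t|)‖ * ‖charFactor c (vline σ (-|t|))‖ := by
  have key : ∀ s : ℝ, ‖charFun c (vline σ s)‖ =
      ‖charFactor c (vline σ s)‖ * ‖charFactor c (vline σ (-s))‖ := fun s => by
    rw [charFun_eq_mul_conj, norm_mul, RCLike.norm_conj, conj_vline]
  rcases abs_choice t with h | h <;> rw [h, key]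
  rw [neg_neg, mul_comm]

/-! ### Lower bounds for the characteristic function -/

theorem abs_sinh_le_cosh_mul (s : ℝ) : |Real.sinh s| ≤ Real.cosh s * |s| := by
  have mean_value := (convex_Icc (-|s|) |s|).norm_image_sub_le_of_norm_hasDerivWithin_le
    (f := Real.sinh) (f' := Real.cosh) (C := Real.cosh s) (x := 0) (y := s)
    (fun x _ => (Real.hasDerivAt_sinh x).hasDerivWithinAt)
    (fun x hx => by
      rw [Real.norm_eq_abs, abs_of_pos (Real.cosh_pos x)]
      exact Real.cosh_le_cosh.2 (abs_le.2 hx))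
    (by simp) ⟨neg_abs_le s, le_abs_self s⟩
  simpa using mean_value

theorem cosh_le_of_abs_le {s : ℝ} (hs : |s| ≤ 1 / 8) : Real.cosh s ≤ 101 / 100 :=
  calc Real.cosh s ≤ Real.cosh (1 / 8) := by
        rwa [Real.cosh_le_cosh, abs_of_pos (a := 1 / 8) (by norm_num)]
    _ ≤ Real.exp ((1 / 8) ^ 2 / 2) := Real.cosh_le_exp_half_sq _
    _ ≤ 1 / (1 - (1 / 8) ^ 2 / 2) :=
        Real.exp_bound_div_one_sub_of_interval (by norm_num) (by norm_num)
    _ ≤ 101 / 100 := by norm_num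

theorem abs_sinh_le_of_abs_le {s : ℝ} (hs : |s| ≤ 1 / 8) : |Real.sinh s| ≤ 101 / 100 * |s| :=
  (abs_sinh_le_cosh_mul s).trans (by gcongr; exact cosh_le_of_abs_le hs)

theorem exp_le_two_of_abs_le {s : ℝ} (hs : |s| ≤ 1 / 8) : Real.exp s ≤ 2 := by
  rw [← Real.cosh_add_sinh]
  linarith [cosh_le_of_abs_le hs, abs_sinh_le_of_abs_le hs, le_abs_self (Real.sinh s)]

theorem le_cos_half {t : ℝ} (ht : |t| ≤ 11 / 5) : 79 / 200 ≤ Real.cos (t / 2) := by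
  have ht2 : t ^ 2 ≤ (11 / 5) ^ 2 := sq_le_sq' (abs_le.1 ht).1 (abs_le.1 ht).2
  linarith [Real.one_sub_sq_div_two_le_cos (x := t / 2)]

theorem abs_sin_half_le {t : ℝ} (ht : |t| ≤ 11 / 5) : |Real.sin (t / 2)| ≤ 23 / 25 := by
  refine abs_le_of_sq_le_sq ?_ (by norm_num)
  nlinarith [le_cos_half ht, Real.sin_sq_add_cos_sq (t / 2)]

section LowerBounds

variable {c σ t : ℝ}

theorem abs_half_le (hσ : |σ| ≤ 1 / 4) : |σ / 2| ≤ 1 / 8 := by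
  rw [abs_div, abs_two]; linarith

theorem abs_le_abs_mul (hc : 1 ≤ c) (s : ℝ) : |s| ≤ |c * s| := by
  rw [abs_mul, abs_of_pos (one_pos.trans_le hc)]
  exact le_mul_of_one_le_left (abs_nonneg s) hc

theorem le_abs_charFactor_vline_re (hc : 1 ≤ c) (hσ : |σ| ≤ 1 / 4) (ht : |t| ≤ 11 / 5) :
    |σ| / 20 ≤ |(charFactor c (vline σ t)).re| := by
  have sinh_le : |Real.sinh (σ / 2)| ≤ 101 / 200 * |σ| := by
    have h := abs_sinh_le_of_abs_le (abs_half_le hσ)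
    rw [abs_div, abs_two] at h
    linarith
  have perturbation_le : |2 * (Real.sinh (σ / 2) * Real.sin (t / 2))| ≤
      2 * (101 / 200 * |σ| * (23 / 25)) := by
    rw [abs_mul, abs_mul, abs_two]
    gcongr
    exact abs_sin_half_le ht
  rw [charFactor_vline_re]
  linarith [abs_nonneg σ, abs_le_abs_mul hc σ,
    abs_sub_abs_le_abs_add (c * σ) (2 * (Real.sinh (σ / 2) * Real.sin (t / 2)))]

theorem le_norm_charFactor_vline_of_large (hc : 1 ≤ c) (hσ : |σ| ≤ 1 / 4) (ht : 11 / 5 ≤ |t|) :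
    |t| / 20 ≤ ‖charFactor c (vline σ t)‖ := by
  have perturbation_le : |2 * Real.cosh (σ / 2) * Real.cos (t / 2)| ≤ 2 * (101 / 100) * 1 := by
    rw [abs_mul, abs_mul, abs_two, abs_of_pos (Real.cosh_pos _)]
    gcongr
    · exact cosh_le_of_abs_le (abs_half_le hσ)
    · exact Real.abs_cos_le_one _
  refine le_trans ?_ (Complex.abs_im_le_norm _)
  rw [charFactor_vline_im, charPhase]
  linarith [abs_le_abs_mul hc t,
    abs_sub_abs_le_abs_sub (c * t) (2 * Real.cosh (σ / 2) * Real.cos (t / 2))]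

theorem le_norm_charFactor_vline_neg_abs (hc : 1 ≤ c) (ht : |t| ≤ 11 / 5) :
    79 / 100 ≤ ‖charFactor c (vline σ (-|t|))‖ := by
  have cosh_mul_cos : 79 / 200 ≤ Real.cosh (σ / 2) * Real.cos (-|t| / 2) :=
    (le_cos_half (by rwa [abs_neg, abs_abs])).trans
      (le_mul_of_one_le_left (by linarith [le_cos_half (t := -|t|) (by rwa [abs_neg, abs_abs])])
        (Real.one_le_cosh _))
  have hct : 0 ≤ c * |t| := by positivity
  refine le_trans ?_ (Complex.abs_im_le_norm _)
  rw [charFactor_vline_im, charPhase, abs_of_nonpos] <;> linarith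

theorem le_norm_charFun_vline_of_large (hc : 1 ≤ c) (hσ : |σ| ≤ 1 / 4) (ht : 11 / 5 ≤ |t|) :
    (1 + t ^ 2) / 500 ≤ ‖charFun c (vline σ t)‖ := by
  have product_le : |t| / 20 * (|t| / 20) ≤ ‖charFun c (vline σ t)‖ := by
    rw [norm_charFun_vline]
    gcongr
    · simpa using le_norm_charFactor_vline_of_large (t := |t|) hc hσ (by rwa [abs_abs])
    · simpa using le_norm_charFactor_vline_of_large (t := -|t|) hc hσ (by rwa [abs_neg, abs_abs])
  nlinarith [sq_abs t]

theorem le_norm_charFun_vline (hc : 1 ≤ c) (hσ : |σ| ≤ 1 / 4) :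
    |σ| * (1 + t ^ 2) / 400 ≤ ‖charFun c (vline σ t)‖ := by
  rcases le_total |t| (11 / 5) with ht | ht
  · have product_le : |σ| / 20 * (79 / 100) ≤ ‖charFun c (vline σ t)‖ := by
      rw [norm_charFun_vline]
      gcongr
      · exact (le_abs_charFactor_vline_re hc hσ (by rwa [abs_abs])).trans (Complex.abs_re_le_norm _)
      · exact le_norm_charFactor_vline_neg_abs hc ht
    have ht2 : t ^ 2 ≤ (11 / 5) ^ 2 := sq_le_sq' (abs_le.1 ht).1 (abs_le.1 ht).2
    nlinarith [abs_nonneg σ]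
  · nlinarith [le_norm_charFun_vline_of_large hc hσ ht, abs_nonneg σ, sq_nonneg t]

theorem charFun_vline_ne_zero (hc : 1 ≤ c) (hσ : |σ| ≤ 1 / 4) (h0 : σ ≠ 0) :
    charFun c (vline σ t) ≠ 0 :=
  norm_pos_iff.1 (lt_of_lt_of_le (by positivity) (le_norm_charFun_vline hc hσ))

theorem abs_div_norm_charFun_sq_le (hc : 1 ≤ c) (hσ : |σ| ≤ 1 / 4) (h0 : σ ≠ 0)
    (ht : |t| ≤ 11 / 5) :
    |σ| / ‖charFun c (vline σ t)‖ ^ 2 ≤ 2 * charPoisson c σ |t| := by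
  have factor_ge : (|σ| / 20) ^ 2 + charPhase c σ |t| ^ 2 ≤ ‖charFactor c (vline σ |t|)‖ ^ 2 := by
    have re_ge := le_abs_charFactor_vline_re hc hσ (t := |t|) (by rwa [abs_abs])
    rw [← Complex.normSq_eq_norm_sq, Complex.normSq_apply, charFactor_vline_im, ← sq, ← sq,
      ← sq_abs (charFactor c (vline σ |t|)).re]
    gcongr
  have other_ge : 1 / 2 ≤ ‖charFactor c (vline σ (-|t|))‖ ^ 2 := by
    nlinarith [le_norm_charFactor_vline_neg_abs (σ := σ) hc ht]
  rw [norm_charFun_vline, mul_pow, charPoisson]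
  calc _ ≤ |σ| / (((|σ| / 20) ^ 2 + charPhase c σ |t| ^ 2) * (1 / 2)) := by gcongr
    _ = _ := by field_simp

theorem abs_charFun_vline_im_le (hc : c ^ 2 ≤ 25 / 24) (hσ : |σ| ≤ 1 / 4) (ht : |t| ≤ 11 / 5) :
    |(charFun c (vline σ t)).im| ≤ 10 * |σ| := by
  have sinh_le : |Real.sinh σ| ≤ 2 * |σ| := by
    rw [show σ = 2 * (σ / 2) by ring, Real.sinh_two_mul, abs_mul, abs_mul, abs_mul, abs_two,
      abs_of_pos (Real.cosh_pos _)]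
    have hs := abs_sinh_le_of_abs_le (abs_half_le hσ)
    have hC := cosh_le_of_abs_le (abs_half_le hσ)
    nlinarith [abs_nonneg (Real.sinh (σ / 2)), abs_nonneg (σ / 2)]
  rw [charFun_vline_im]
  calc |2 * c ^ 2 * σ * t + 2 * (Real.sinh σ * Real.sin t)|
      ≤ |2 * c ^ 2 * σ * t| + |2 * (Real.sinh σ * Real.sin t)| := abs_add_le _ _
    _ = 2 * c ^ 2 * |σ| * |t| + 2 * (|Real.sinh σ| * |Real.sin t|) := by
        simp only [abs_mul, abs_two, abs_pow, sq_abs]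
    _ ≤ 2 * (25 / 24) * |σ| * (11 / 5) + 2 * (2 * |σ| * 1) := by
        gcongr
        exact Real.abs_sin_le_one t
    _ ≤ 10 * |σ| := by linarith [abs_nonneg σ]

theorem hasDerivAt_charPhase (c σ t : ℝ) :
    HasDerivAt (charPhase c σ) (c + Real.cosh (σ / 2) * Real.sin (t / 2)) t := by
  have hcos := (((hasDerivAt_id t).div_const 2).cos).const_mul (2 * Real.cosh (σ / 2))
  exact (((hasDerivAt_id t).const_mul c).sub hcos).congr_deriv (by simp only [id]; ring)

theorem le_deriv_charPhase (hc : 1 ≤ c) (hσ : |σ| ≤ 1 / 4) (ht : |t| ≤ 11 / 5) :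
    1 / 20 ≤ c + Real.cosh (σ / 2) * Real.sin (t / 2) := by
  have perturbation_le : |Real.cosh (σ / 2) * Real.sin (t / 2)| ≤ 101 / 100 * (23 / 25) := by
    rw [abs_mul, abs_of_pos (Real.cosh_pos _)]
    gcongr
    · exact cosh_le_of_abs_le (abs_half_le hσ)
    · exact abs_sin_half_le ht
  linarith [(abs_le.1 perturbation_le).1]

end LowerBounds

theorem continuous_charPhase (c σ : ℝ) : Continuous (charPhase c σ) := by
  unfold charPhase; fun_prop

theorem continuous_charPoisson (c : ℝ) {σ : ℝ} (h0 : σ ≠ 0) : Continuous (charPoisson c σ) := by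
  have := continuous_charPhase c σ
  exact continuous_const.div (by fun_prop) fun t => by positivity

theorem charPoisson_nonneg (c σ t : ℝ) : 0 ≤ charPoisson c σ t := by
  unfold charPoisson; positivity

/-- The constant is the total mass `π` of the Poisson kernel in the variable `φ t`. -/
theorem integral_div_sq_add_sq_le {φ φ' : ℝ → ℝ} {a b s m : ℝ} (hab : a ≤ b) (hs : 0 < s)
    (hm : 0 < m) (hφ : ∀ t, HasDerivAt φ (φ' t) t) (hφ' : Continuous φ')
    (hle : ∀ t ∈ Set.Icc a b, m ≤ φ' t) :
    ∫ t in a..b, s / (s ^ 2 + φ t ^ 2) ≤ Real.pi / m := by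
  have hφc : Continuous φ := continuous_iff_continuousAt.2 fun t => (hφ t).continuousAt
  have hf : Continuous fun t => s / (s ^ 2 + φ t ^ 2) :=
    continuous_const.div (by fun_prop) fun t => by positivity
  have arctan_deriv : ∀ t, HasDerivAt (fun t => Real.arctan (φ t / s))
      (s / (s ^ 2 + φ t ^ 2) * φ' t) t := fun t =>
    (((hφ t).div_const s).arctan).congr_deriv (by field_simp)
  rw [le_div_iff₀ hm, ← intervalIntegral.integral_mul_const]
  calc ∫ t in a..b, s / (s ^ 2 + φ t ^ 2) * m
      ≤ ∫ t in a..b, s / (s ^ 2 + φ t ^ 2) * φ' t := by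
        refine intervalIntegral.integral_mono_on hab
          (Continuous.intervalIntegrable (by fun_prop) _ _)
          (Continuous.intervalIntegrable (by fun_prop) _ _) fun t ht => ?_
        gcongr
        exact hle t ht
    _ = Real.arctan (φ b / s) - Real.arctan (φ a / s) :=
        intervalIntegral.integral_eq_sub_of_hasDerivAt (fun t _ => arctan_deriv t)
          (Continuous.intervalIntegrable (by fun_prop) _ _)
    _ ≤ Real.pi := by
        linarith [Real.arctan_lt_pi_div_two (φ b / s), Real.neg_pi_div_two_lt_arctan (φ a / s)]

theorem integral_charPoisson_le {c σ : ℝ} (hc : 1 ≤ c) (hσ : |σ| ≤ 1 / 4) (h0 : σ ≠ 0) :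
    ∫ t in (-(11 / 5) : ℝ)..(11 / 5), charPoisson c σ t ≤ 400 * Real.pi := by
  have bound := integral_div_sq_add_sq_le (a := -(11 / 5)) (b := 11 / 5) (s := |σ| / 20)
    (m := 1 / 20) (by norm_num) (by positivity) (by norm_num) (hasDerivAt_charPhase c σ)
    (by fun_prop) fun t ht => le_deriv_charPhase hc hσ (abs_le.2 ht)
  have rescale : ∀ t, charPoisson c σ t =
      20 * (|σ| / 20 / ((|σ| / 20) ^ 2 + charPhase c σ t ^ 2)) := fun t => by
    rw [charPoisson]; ring
  simp only [rescale, intervalIntegral.integral_const_mul]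
  linarith

/-! ### Integrals along vertical lines -/

theorem integral_const_div_one_add_sq (M : ℝ) : ∫ t : ℝ, M / (1 + t ^ 2) = M * Real.pi := by
  simp only [div_eq_mul_inv]
  rw [integral_const_mul, integral_univ_inv_one_add_sq]

theorem integrable_const_div_one_add_sq (M : ℝ) : Integrable fun t : ℝ => M / (1 + t ^ 2) := by
  simpa only [div_eq_mul_inv] using integrable_inv_one_add_sq.const_mul M

theorem integrable_of_norm_le_div_one_add_sq {E : Type*} [NormedAddCommGroup E] {f : ℝ → E}
    {M : ℝ} (hf : Continuous f) (hM : ∀ t, ‖f t‖ ≤ M / (1 + t ^ 2)) : Integrable f :=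
  (integrable_const_div_one_add_sq M).mono' hf.aestronglyMeasurable (Eventually.of_forall hM)

theorem contourIntegral_eq (σ : ℝ) (F : ℂ → ℂ) :
    contourIntegral σ F = (2 * Real.pi : ℂ)⁻¹ * ∫ t : ℝ, F (vline σ t) := by
  have := Complex.ofReal_ne_zero.2 Real.pi_ne_zero
  rw [contourIntegral, integral_mul_const]
  field_simp

theorem contourIntegral_comp_neg (σ : ℝ) (F : ℂ → ℂ) :
    contourIntegral σ (fun z => F (-z)) = contourIntegral (-σ) F := by
  simp only [contourIntegral_eq, neg_vline]
  rw [integral_neg_eq_self fun t => F (vline (-σ) t)]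

theorem norm_two_pi_inv : ‖(2 * Real.pi : ℂ)⁻¹‖ = (2 * Real.pi)⁻¹ := by
  simp [abs_of_pos Real.pi_pos]

theorem norm_contourIntegral_le {σ : ℝ} {F : ℂ → ℂ} {b : ℝ → ℝ} (hb : Integrable b)
    (h : ∀ t, ‖F (vline σ t)‖ ≤ b t) : ‖contourIntegral σ F‖ ≤ (2 * Real.pi)⁻¹ * ∫ t, b t := by
  rw [contourIntegral_eq, norm_mul, norm_two_pi_inv]
  gcongr
  exact norm_integral_le_of_norm_le hb (Eventually.of_forall h)

section ContourShift

variable {F : ℂ → ℂ} {σ₁ σ₂ M : ℝ}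

theorem integral_boundary_vline_eq_zero (h : σ₁ ≤ σ₂)
    (hd : ∀ σ ∈ Set.Icc σ₁ σ₂, ∀ t, DifferentiableAt ℂ F (vline σ t)) (T : ℝ) :
    (∫ x in σ₁..σ₂, F (vline x (-T))) - (∫ x in σ₁..σ₂, F (vline x T)) +
      Complex.I • (∫ t in (-T)..T, F (vline σ₂ t)) -
      Complex.I • (∫ t in (-T)..T, F (vline σ₁ t)) = 0 := by
  have rect := Complex.integral_boundary_rect_eq_zero_of_differentiableOn F (vline σ₁ (-T))
    (vline σ₂ T) fun z hz => by
      rw [Complex.mem_reProdIm, vline_re, vline_re, Set.uIcc_of_le h] at hz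
      exact (vline_re_im z ▸ hd _ hz.1 z.im).differentiableWithinAt
  simp only [vline_re, vline_im] at rect
  exact rect

theorem tendsto_integral_horizontal (h : σ₁ ≤ σ₂)
    (hM : ∀ σ ∈ Set.Icc σ₁ σ₂, ∀ t, ‖F (vline σ t)‖ ≤ M / (1 + t ^ 2)) {τ : ℝ → ℝ}
    (hτ : Tendsto (fun T => τ T ^ 2) atTop atTop) :
    Tendsto (fun T => ∫ x in σ₁..σ₂, F (vline x (τ T))) atTop (𝓝 0) := by
  have bound_tendsto : Tendsto (fun T => M / (1 + τ T ^ 2) * |σ₂ - σ₁|) atTop (𝓝 0) := by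
    simpa using ((tendsto_atTop_add_const_left _ 1 hτ).const_div_atTop M).mul_const |σ₂ - σ₁|
  refine squeeze_zero_norm (fun T => ?_) bound_tendsto
  refine intervalIntegral.norm_integral_le_of_norm_le_const fun x hx => ?_
  rw [Set.uIoc_of_le h] at hx
  exact hM x (Set.Ioc_subset_Icc_self hx) (τ T)

theorem integral_vline_eq (h : σ₁ ≤ σ₂)
    (hd : ∀ σ ∈ Set.Icc σ₁ σ₂, ∀ t, DifferentiableAt ℂ F (vline σ t))
    (hM : ∀ σ ∈ Set.Icc σ₁ σ₂, ∀ t, ‖F (vline σ t)‖ ≤ M / (1 + t ^ 2)) :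
    ∫ t, F (vline σ₁ t) = ∫ t, F (vline σ₂ t) := by
  have vertical : ∀ σ ∈ Set.Icc σ₁ σ₂,
      Tendsto (fun T : ℝ => ∫ t in (-T)..T, F (vline σ t)) atTop (𝓝 (∫ t, F (vline σ t))) := by
    intro σ hσ
    have hcont : Continuous fun t => F (vline σ t) := continuous_iff_continuousAt.2 fun t =>
      (hd σ hσ t).continuousAt.comp (continuous_vline σ).continuousAt
    exact intervalIntegral_tendsto_integral (integrable_of_norm_le_div_one_add_sq hcont (hM σ hσ))
      tendsto_neg_atTop_atBot tendsto_id
  have top := tendsto_integral_horizontal h hM (τ := id) (tendsto_pow_atTop two_ne_zero)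
  have bottom := tendsto_integral_horizontal h hM (τ := Neg.neg) (by
    simpa only [neg_sq] using tendsto_pow_atTop two_ne_zero)
  have boundary := ((bottom.sub top).add
    ((vertical σ₂ (Set.right_mem_Icc.2 h)).const_smul Complex.I)).sub
    ((vertical σ₁ (Set.left_mem_Icc.2 h)).const_smul Complex.I)
  simp only [id, integral_boundary_vline_eq_zero h hd] at boundary
  have limit_eq := tendsto_nhds_unique boundary tendsto_const_nhds
  rw [sub_zero, zero_add, ← smul_sub, smul_eq_zero_iff_right Complex.I_ne_zero] at limit_eq
  exact (sub_eq_zero.1 limit_eq).symm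

end ContourShift

/-! ### The Green's function -/

/-- The Green's function of `B_c` on the space of exponential weight `σ`, as the inverse bilateral
Laplace transform of `1 / charFun c` along `Re z = σ`. -/
def green (c σ y : ℝ) : ℂ := contourIntegral σ (kernelK c y)

theorem kernelK_eq (c y : ℝ) (z : ℂ) : kernelK c y z = Complex.exp (y * z) / charFun c z := by
  rw [kernelK, symbolB_I_mul]

theorem norm_exp_mul_vline (y σ t : ℝ) : ‖Complex.exp (y * vline σ t)‖ = Real.exp (y * σ) := by
  rw [Complex.norm_exp, Complex.re_ofReal_mul, vline_re]

theorem norm_kernelK_vline (c y σ t : ℝ) :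
    ‖kernelK c y (vline σ t)‖ = Real.exp (y * σ) / ‖charFun c (vline σ t)‖ := by
  rw [kernelK_eq, norm_div, norm_exp_mul_vline]

theorem kernelK_neg (c y : ℝ) (z : ℂ) : kernelK c (-y) (-z) = kernelK c y z := by
  rw [kernelK_eq, kernelK_eq, charFun_neg, Complex.ofReal_neg, neg_mul_neg]

theorem green_neg (c σ y : ℝ) : green c (-σ) (-y) = green c σ y := by
  rw [green, green, ← contourIntegral_comp_neg]
  simp only [kernelK_neg]

section Green

variable {c σ : ℝ}

theorem norm_kernelK_vline_le (hc : 1 ≤ c) (hσ : |σ| ≤ 1 / 4) (h0 : σ ≠ 0) (y t : ℝ) :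
    ‖kernelK c y (vline σ t)‖ ≤ (400 / |σ| * Real.exp (y * σ)) / (1 + t ^ 2) := by
  rw [norm_kernelK_vline]
  calc Real.exp (y * σ) / ‖charFun c (vline σ t)‖
      ≤ Real.exp (y * σ) / (|σ| * (1 + t ^ 2) / 400) := by
        gcongr; exact le_norm_charFun_vline hc hσ
    _ = _ := by field_simp

theorem continuous_kernelK_vline (hc : 1 ≤ c) (hσ : |σ| ≤ 1 / 4) (h0 : σ ≠ 0) :
    Continuous fun x : ℝ × ℝ => kernelK c x.1 (vline σ x.2) := by
  have := continuous_vline σ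
  have := continuous_charFun c
  simp only [kernelK_eq]
  exact Continuous.div (by fun_prop) (by fun_prop) fun x => charFun_vline_ne_zero hc hσ h0

theorem integrable_kernelK_vline (hc : 1 ≤ c) (hσ : |σ| ≤ 1 / 4) (h0 : σ ≠ 0) (y : ℝ) :
    Integrable fun t => kernelK c y (vline σ t) :=
  integrable_of_norm_le_div_one_add_sq
    ((continuous_kernelK_vline hc hσ h0).comp (Continuous.prodMk_right y))
    (norm_kernelK_vline_le hc hσ h0 y)

theorem measurable_green (hc : 1 ≤ c) (hσ : |σ| ≤ 1 / 4) (h0 : σ ≠ 0) :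
    Measurable (green c σ) := by
  simp only [funext fun y => show green c σ y = _ from contourIntegral_eq σ (kernelK c y)]
  exact (StronglyMeasurable.integral_prod_right (f := fun y t => kernelK c y (vline σ t))
    (continuous_kernelK_vline hc hσ h0).stronglyMeasurable).measurable.const_mul _

theorem norm_green_le (hc : 1 ≤ c) (hσ : |σ| ≤ 1 / 4) (h0 : σ ≠ 0) (y : ℝ) :
    ‖green c σ y‖ ≤ 200 / |σ| * Real.exp (y * σ) := by
  refine (norm_contourIntegral_le (integrable_const_div_one_add_sq _)
    (norm_kernelK_vline_le hc hσ h0 y)).trans_eq ?_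
  rw [integral_const_div_one_add_sq]
  field_simp
  norm_num

theorem green_eq_of_pos {σ₁ σ₂ : ℝ} (hc : 1 ≤ c) (hσ₁ : 0 < σ₁) (h : σ₁ ≤ σ₂) (hσ₂ : σ₂ ≤ 1 / 4)
    (y : ℝ) : green c σ₁ y = green c σ₂ y := by
  have pos : ∀ σ ∈ Set.Icc σ₁ σ₂, 0 < σ := fun σ hσ => hσ₁.trans_le hσ.1
  have abs_le : ∀ σ ∈ Set.Icc σ₁ σ₂, |σ| ≤ 1 / 4 := fun σ hσ => by
    rw [abs_of_pos (pos σ hσ)]; exact hσ.2.trans hσ₂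
  rw [green, green, contourIntegral_eq, contourIntegral_eq]
  congr 1
  refine integral_vline_eq (M := 400 / σ₁ * Real.exp (|y| * (1 / 4))) h (fun σ hσ t => ?_)
    fun σ hσ t => (norm_kernelK_vline_le hc (abs_le σ hσ) (pos σ hσ).ne' y t).trans ?_
  · simp only [funext (kernelK_eq c y)]
    refine DifferentiableAt.div (by fun_prop) ?_
      (charFun_vline_ne_zero hc (abs_le σ hσ) (pos σ hσ).ne')
    unfold charFun
    fun_prop
  · have exponent_le : y * σ ≤ |y| * (1 / 4) := by
      refine (le_abs_self _).trans ?_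
      rw [abs_mul]
      gcongr
      exact abs_le σ hσ
    gcongr
    exact hσ.1.trans (le_abs_self σ)

theorem green_eq_of_neg {σ₁ σ₂ : ℝ} (hc : 1 ≤ c) (hσ₁ : -(1 / 4) ≤ σ₁) (h : σ₁ ≤ σ₂) (hσ₂ : σ₂ < 0)
    (y : ℝ) : green c σ₁ y = green c σ₂ y := by
  rw [← neg_neg σ₁, ← neg_neg σ₂, ← neg_neg y, green_neg, green_neg c (-σ₂)]
  exact (green_eq_of_pos hc (by linarith) (by linarith) (by linarith) _).symm

/-! ### Decay of the Green's function -/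

theorem norm_exp_mul_conj_sub_le (p : ℂ) (s : ℝ) :
    ‖(Real.exp s : ℂ) * conj p - Real.exp (-s) * p‖ ≤
      2 * (|Real.sinh s| * ‖p‖ + Real.cosh s * |p.im|) := by
  have expand : (Real.exp s : ℂ) * conj p - Real.exp (-s) * p =
      2 * (Real.sinh s * p.re - Real.cosh s * p.im * Complex.I) := by
    apply Complex.ext <;> simp [Real.sinh_eq, Real.cosh_eq, -Complex.ofReal_sinh,
      -Complex.ofReal_cosh, -Complex.ofReal_exp] <;> ring
  rw [expand, norm_mul, Complex.norm_ofNat]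
  gcongr
  refine (norm_sub_le _ _).trans ?_
  rw [norm_mul, norm_mul, norm_mul, Complex.norm_I, mul_one, Complex.norm_real, Complex.norm_real,
    Complex.norm_real, Complex.norm_real, Real.norm_eq_abs, Real.norm_eq_abs, Real.norm_eq_abs,
    Real.norm_eq_abs, abs_of_pos (Real.cosh_pos s)]
  gcongr
  exact Complex.abs_re_le_norm p

theorem norm_kernelK_vline_sub {t : ℝ} (hp : charFun c (vline σ t) ≠ 0) (y : ℝ) :
    ‖kernelK c y (vline σ t) - kernelK c y (vline (-σ) t)‖ =
      ‖(Real.exp (y * σ) : ℂ) * conj (charFun c (vline σ t)) -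
        Real.exp (-(y * σ)) * charFun c (vline σ t)‖ / ‖charFun c (vline σ t)‖ ^ 2 := by
  have hp' : conj (charFun c (vline σ t)) ≠ 0 := (map_ne_zero _).2 hp
  have exp_eq : ∀ s : ℝ, Complex.exp (y * vline s t) =
      Complex.exp ((y * t : ℝ) * Complex.I) * Real.exp (y * s) := fun s => by
    rw [Complex.ofReal_exp, ← Complex.exp_add, vline]
    congr 1
    push_cast
    ring
  have quotient_eq : kernelK c y (vline σ t) - kernelK c y (vline (-σ) t) =
      Complex.exp ((y * t : ℝ) * Complex.I) *
        ((Real.exp (y * σ) : ℂ) * conj (charFun c (vline σ t)) -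
          Real.exp (-(y * σ)) * charFun c (vline σ t)) /
        (charFun c (vline σ t) * conj (charFun c (vline σ t))) := by
    rw [kernelK_eq, kernelK_eq, charFun_vline_neg_left, exp_eq, exp_eq, mul_neg]
    field_simp
  rw [quotient_eq, norm_div, norm_mul, norm_mul, Complex.norm_exp_ofReal_mul_I, one_mul,
    RCLike.norm_conj, sq]

theorem norm_kernelK_vline_sub_le {y t : ℝ} (hc : 1 ≤ c) (hc' : c ^ 2 ≤ 25 / 24)
    (hσ : |σ| ≤ 1 / 4) (h0 : σ ≠ 0) (hy : |y * σ| ≤ 1 / 8) (ht : |t| ≤ 11 / 5) :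
    ‖kernelK c y (vline σ t) - kernelK c y (vline (-σ) t)‖ ≤
      2 * (y ^ 2 * |σ|) + 44 * charPoisson c σ |t| := by
  have hp := charFun_vline_ne_zero (t := t) hc hσ h0
  have poisson := abs_div_norm_charFun_sq_le hc hσ h0 ht
  have im_le := abs_charFun_vline_im_le hc' hσ ht
  have sinh_le := abs_sinh_le_of_abs_le hy
  rw [abs_mul] at sinh_le
  rw [norm_kernelK_vline_sub hp]
  set p := charFun c (vline σ t)
  have : 0 < ‖p‖ := norm_pos_iff.2 hp
  have am_gm : 2 * (|y| / ‖p‖) ≤ y ^ 2 + 1 / ‖p‖ ^ 2 := by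
    have := two_mul_le_add_sq |y| (1 / ‖p‖)
    rw [sq_abs, div_pow, one_pow] at this
    exact le_trans (by rw [mul_assoc, mul_one_div]) this
  calc ‖(Real.exp (y * σ) : ℂ) * conj p - Real.exp (-(y * σ)) * p‖ / ‖p‖ ^ 2
      ≤ 2 * (101 / 100 * (|y| * |σ|) * ‖p‖ + 101 / 100 * (10 * |σ|)) / ‖p‖ ^ 2 := by
        gcongr
        refine (norm_exp_mul_conj_sub_le p _).trans ?_
        gcongr
        exact cosh_le_of_abs_le hy
    _ = 101 / 100 * |σ| * (2 * (|y| / ‖p‖)) + 101 / 5 * (|σ| / ‖p‖ ^ 2) := by field_simp; ring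
    _ ≤ 101 / 100 * |σ| * (y ^ 2 + 1 / ‖p‖ ^ 2) + 101 / 5 * (|σ| / ‖p‖ ^ 2) := by gcongr
    _ = 101 / 100 * (y ^ 2 * |σ|) + 2121 / 100 * (|σ| / ‖p‖ ^ 2) := by ring
    _ ≤ 2 * (y ^ 2 * |σ|) + 44 * charPoisson c σ |t| := by
        have : 0 ≤ y ^ 2 * |σ| := by positivity
        linarith [charPoisson_nonneg c σ |t|]

theorem norm_kernelK_vline_le_of_large {y t : ℝ} (hc : 1 ≤ c) (hσ : |σ| ≤ 1 / 4)
    (hy : |y * σ| ≤ 1 / 8) (ht : 11 / 5 ≤ |t|) :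
    ‖kernelK c y (vline σ t)‖ ≤ 1000 / (1 + t ^ 2) := by
  rw [norm_kernelK_vline]
  calc Real.exp (y * σ) / ‖charFun c (vline σ t)‖ ≤ 2 / ((1 + t ^ 2) / 500) := by
        gcongr
        · exact exp_le_two_of_abs_le hy
        · exact le_norm_charFun_vline_of_large hc hσ ht
    _ = 1000 / (1 + t ^ 2) := by field_simp; norm_num

/-- A majorant, integrable uniformly in `σ`, for the jump of `kernelK c y` between the lines
`Re z = ±σ`: the lines pass on either side of the poles of the kernel at `|t| ≤ 11 / 5`. -/
def jumpBound (c σ t : ℝ) : ℝ :=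
  (Set.Ioc (-(11 / 5)) (11 / 5)).indicator
    (fun t => 44 * (charPoisson c σ t + charPoisson c σ (-t))) t + 2000 / (1 + t ^ 2)

theorem integrable_indicator_charPoisson (h0 : σ ≠ 0) :
    Integrable ((Set.Ioc (-(11 / 5) : ℝ) (11 / 5)).indicator
      fun t => 44 * (charPoisson c σ t + charPoisson c σ (-t))) := by
  have := continuous_charPoisson c h0
  rw [integrable_indicator_iff measurableSet_Ioc]
  exact Continuous.integrableOn_Ioc (by fun_prop)

theorem integrable_jumpBound (h0 : σ ≠ 0) : Integrable (jumpBound c σ) :=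
  (integrable_indicator_charPoisson h0).add (integrable_const_div_one_add_sq 2000)

theorem integral_jumpBound_le (hc : 1 ≤ c) (hσ : |σ| ≤ 1 / 4) (h0 : σ ≠ 0) :
    ∫ t, jumpBound c σ t ≤ 40000 * Real.pi := by
  have hcont := continuous_charPoisson c h0
  unfold jumpBound
  rw [integral_add (integrable_indicator_charPoisson h0) (integrable_const_div_one_add_sq 2000),
    integral_const_div_one_add_sq, integral_indicator measurableSet_Ioc,
    ← intervalIntegral.integral_of_le (by norm_num), intervalIntegral.integral_const_mul,
    intervalIntegral.integral_add (hcont.intervalIntegrable _ _)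
      (Continuous.intervalIntegrable (by fun_prop) _ _),
    intervalIntegral.integral_comp_neg, neg_neg]
  linarith [integral_charPoisson_le hc hσ h0, Real.pi_pos]

theorem norm_kernelK_vline_sub_le_jumpBound {y : ℝ} (hc : 1 ≤ c) (hc' : c ^ 2 ≤ 25 / 24)
    (hσ : |σ| ≤ 1 / 4) (h0 : σ ≠ 0) (hy : |y * σ| ≤ 1 / 8) (hy2 : y ^ 2 * |σ| ≤ 1 / 4) (t : ℝ) :
    ‖kernelK c y (vline σ t) - kernelK c y (vline (-σ) t)‖ ≤ jumpBound c σ t := by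
  rw [jumpBound]
  by_cases ht : t ∈ Set.Ioc (-(11 / 5)) (11 / 5)
  · have ht' : |t| ≤ 11 / 5 := abs_le.2 ⟨ht.1.le, ht.2⟩
    have poisson_le : charPoisson c σ |t| ≤ charPoisson c σ t + charPoisson c σ (-t) := by
      rcases abs_choice t with h | h <;> rw [h] <;>
        linarith [charPoisson_nonneg c σ t, charPoisson_nonneg c σ (-t)]
    have one_le : 1 ≤ 2000 / (1 + t ^ 2) := by
      rw [one_le_div (by positivity)]
      nlinarith [ht.1, ht.2]
    rw [Set.indicator_of_mem ht]
    linarith [norm_kernelK_vline_sub_le hc hc' hσ h0 hy ht']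
  · have ht' : 11 / 5 ≤ |t| := by
      by_contra! h
      exact ht ⟨(abs_lt.1 h).1, (abs_lt.1 h).2.le⟩
    rw [Set.indicator_of_notMem ht, zero_add]
    calc _ ≤ 1000 / (1 + t ^ 2) + 1000 / (1 + t ^ 2) := norm_sub_le_of_le
          (norm_kernelK_vline_le_of_large hc hσ hy ht')
          (norm_kernelK_vline_le_of_large hc (by rwa [abs_neg]) (by rwa [mul_neg, abs_neg]) ht')
      _ = 2000 / (1 + t ^ 2) := by ring

theorem norm_green_sub_le_of_small {y : ℝ} (hc : 1 ≤ c) (hc' : c ^ 2 ≤ 25 / 24)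
    (hσ : |σ| ≤ 1 / 4) (h0 : σ ≠ 0) (hy : |y * σ| ≤ 1 / 8) (hy2 : y ^ 2 * |σ| ≤ 1 / 4) :
    ‖green c σ y - green c (-σ) y‖ ≤ 20000 := by
  rw [green, green, contourIntegral_eq, contourIntegral_eq, ← mul_sub, norm_mul, norm_two_pi_inv,
    ← integral_sub (integrable_kernelK_vline hc hσ h0 y)
      (integrable_kernelK_vline hc (by rwa [abs_neg]) (neg_ne_zero.2 h0) y)]
  calc _ ≤ (2 * Real.pi)⁻¹ * (40000 * Real.pi) := by
        gcongr
        exact (norm_integral_le_of_norm_le (integrable_jumpBound h0) (Eventually.of_forall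
          (norm_kernelK_vline_sub_le_jumpBound hc hc' hσ h0 hy hy2))).trans
          (integral_jumpBound_le hc hσ h0)
    _ = 20000 := by field_simp; norm_num

/-- The jump does not depend on `σ`, so that `σ` may be chosen small in terms of `y`. -/
theorem norm_green_sub_le (hc : 1 ≤ c) (hc' : c ^ 2 ≤ 25 / 24) (hσ : 0 < σ) (hσ' : σ ≤ 1 / 4)
    (y : ℝ) : ‖green c σ y - green c (-σ) y‖ ≤ 20000 := by
  set s : ℝ := min σ (1 / (4 * (1 + y ^ 2)))
  have hs0 : 0 < s := lt_min hσ (by positivity)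
  have hsσ : s ≤ σ := min_le_left _ _
  have hsy : s * (4 * (1 + y ^ 2)) ≤ 1 := (le_div_iff₀ (by positivity)).1 (min_le_right _ _)
  rw [← green_eq_of_pos hc hs0 hsσ hσ',
    green_eq_of_neg hc (neg_le_neg hσ') (neg_le_neg hsσ) (neg_neg_of_pos hs0)]
  have hy : |y| * s ≤ 1 / 8 := by
    nlinarith [mul_nonneg hs0.le (sq_nonneg (1 - |y|)), sq_abs y]
  refine norm_green_sub_le_of_small hc hc' ?_ hs0.ne' ?_ ?_
  · rw [abs_of_pos hs0]; exact hsσ.trans hσ'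
  · rwa [abs_mul, abs_of_pos hs0]
  · rw [abs_of_pos hs0]; nlinarith

/-- On the side of the origin where the decay of `green c σ` cannot be read off its contour, it is
compared with `green c (-σ)`, at the cost of the jump. -/
theorem norm_green_le_exp_of_pos (hc : 1 ≤ c) (hc' : c ^ 2 ≤ 25 / 24) (hσ : 0 < σ)
    (hσ' : σ ≤ 1 / 8) (y : ℝ) :
    ‖green c σ y‖ ≤ 21000 * Real.exp (σ * y - σ * |y|) := by
  have abs_quarter : |(1 / 4 : ℝ)| = 1 / 4 := abs_of_pos (by norm_num)
  rw [green_eq_of_pos hc hσ (by linarith : σ ≤ 1 / 4) le_rfl]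
  rcases le_total 0 y with hy | hy
  · have hneg := norm_green_le (σ := -(1 / 4)) hc (by rw [abs_neg, abs_quarter]) (by norm_num) y
    rw [abs_neg, abs_quarter] at hneg
    have hexp : Real.exp (y * -(1 / 4)) ≤ 1 := Real.exp_le_one_iff.2 (by linarith)
    rw [abs_of_nonneg hy, sub_self, Real.exp_zero]
    linarith [norm_green_sub_le hc hc' (by norm_num) le_rfl y,
      norm_sub_norm_le (green c (1 / 4) y) (green c (-(1 / 4)) y)]
  · have hpos := norm_green_le (σ := 1 / 4) hc abs_quarter.le (by norm_num) y
    rw [abs_quarter] at hpos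
    have hexp : Real.exp (y * (1 / 4)) ≤ Real.exp (σ * y - σ * |y|) := by
      rw [abs_of_nonpos hy, Real.exp_le_exp]
      nlinarith
    linarith [Real.exp_pos (y * (1 / 4))]

theorem norm_green_le_exp (hc : 1 ≤ c) (hc' : c ^ 2 ≤ 25 / 24) (hσ : |σ| ≤ 1 / 8) (h0 : σ ≠ 0)
    (y : ℝ) : ‖green c σ y‖ ≤ 21000 * Real.exp (σ * y - |σ| * |y|) := by
  rcases lt_or_gt_of_ne h0 with h | h
  · rw [abs_of_neg h] at hσ ⊢
    simpa [← green_neg c σ y] using norm_green_le_exp_of_pos hc hc' (neg_pos.2 h) hσ (-y)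
  · rw [abs_of_pos h] at hσ ⊢
    exact norm_green_le_exp_of_pos hc hc' h hσ y

end Green

/-! ### Complex-valued test functions and weak derivatives -/

/-- Complex-valued test functions on the line. Weak derivatives are defined by pairing with
real-valued ones; the complex class is the one preserved by multiplication by `e^{xz}` and by
convolution with a complex kernel. -/
structure IsTestFun (φ : ℝ → ℂ) : Prop where
  contDiff : ContDiff ℝ ∞ φ
  hasCompactSupport : HasCompactSupport φ

section TestFunctions

variable {φ ψ u v w : ℝ → ℂ}

theorem IsTestFun.continuous (hφ : IsTestFun φ) : Continuous φ :=
  hφ.contDiff.continuous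

theorem hasDerivAt_of_contDiff (hψ : ContDiff ℝ ∞ ψ) (x : ℝ) : HasDerivAt ψ (deriv ψ x) x :=
  (hψ.differentiable (by simp) x).hasDerivAt

theorem contDiff_deriv (hψ : ContDiff ℝ ∞ ψ) : ContDiff ℝ ∞ (deriv ψ) :=
  (contDiff_infty_iff_deriv.1 hψ).2

theorem IsTestFun.deriv (hφ : IsTestFun φ) : IsTestFun (deriv φ) :=
  ⟨contDiff_deriv hφ.contDiff, hφ.hasCompactSupport.deriv⟩

theorem IsTestFun.mul_contDiff (hφ : IsTestFun φ) (hψ : ContDiff ℝ ∞ ψ) :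
    IsTestFun fun x => φ x * ψ x :=
  ⟨hφ.contDiff.mul hψ, hφ.hasCompactSupport.mul_right⟩

theorem IsTestFun.comp_add_right (hφ : IsTestFun φ) (d : ℝ) : IsTestFun fun x => φ (x + d) :=
  ⟨hφ.contDiff.comp (contDiff_id.add contDiff_const),
    hφ.hasCompactSupport.comp_homeomorph (Homeomorph.addRight d)⟩

theorem IsTestFun.integrable_mul (hφ : IsTestFun φ) (hu : LocallyIntegrable u) :
    Integrable fun x => φ x * u x :=
  hu.integrable_smul_left_of_hasCompactSupport hφ.continuous hφ.hasCompactSupport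

theorem isTestFun_ofReal {φ : ℝ → ℝ} (hφ : ContDiff ℝ ∞ φ) (hs : HasCompactSupport φ) :
    IsTestFun fun x => (φ x : ℂ) :=
  ⟨Complex.ofRealCLM.contDiff.comp hφ, hs.comp_left Complex.ofReal_zero⟩

theorem ae_eq_of_integral_testFun_mul_eq (hu : LocallyIntegrable u) (hv : LocallyIntegrable v)
    (h : ∀ φ, IsTestFun φ → ∫ x, φ x * u x = ∫ x, φ x * v x) : u =ᵐ[volume] v := by
  refine ae_eq_of_integral_contDiff_smul_eq hu hv fun φ hφ hs => ?_
  simpa only [Complex.real_smul] using h _ (isTestFun_ofReal hφ hs)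

theorem iteratedDeriv_clm_comp {E F : Type*} [NormedAddCommGroup E] [NormedSpace ℝ E]
    [NormedAddCommGroup F] [NormedSpace ℝ F] (L : E →L[ℝ] F) {f : ℝ → E} {k : ℕ}
    (hf : ContDiff ℝ k f) (x : ℝ) :
    iteratedDeriv k (fun y => L (f y)) x = L (iteratedDeriv k f x) := by
  have h := L.iteratedFDeriv_comp_left hf.contDiffAt (x := x) le_rfl
  rw [iteratedDeriv, iteratedDeriv]
  exact congrArg (fun T => T fun _ => 1) h

theorem IsWeakDeriv.integral_iteratedDeriv_mul {k : ℕ} (h : IsWeakDeriv k u v)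
    (hφ : IsTestFun φ) :
    ∫ x, iteratedDeriv k φ x * u x = (-1) ^ k * ∫ x, φ x * v x := by
  have hk : ContDiff ℝ k φ := hφ.contDiff.of_le (mod_cast le_top)
  have hre : ContDiff ℝ ∞ fun x => (φ x).re := Complex.reCLM.contDiff.comp hφ.contDiff
  have him : ContDiff ℝ ∞ fun x => (φ x).im := Complex.imCLM.contDiff.comp hφ.contDiff
  have hsre := hφ.hasCompactSupport.comp_left Complex.zero_re
  have hsim := hφ.hasCompactSupport.comp_left Complex.zero_im
  have hdre (x : ℝ) : (iteratedDeriv k φ x).re = iteratedDeriv k (fun y => (φ y).re) x :=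
    (iteratedDeriv_clm_comp Complex.reCLM hk x).symm
  have hdim (x : ℝ) : (iteratedDeriv k φ x).im = iteratedDeriv k (fun y => (φ y).im) x :=
    (iteratedDeriv_clm_comp Complex.imCLM hk x).symm
  have split (z w : ℂ) : z * w = z.re • w + Complex.I * z.im • w := by
    rw [Complex.real_smul, Complex.real_smul, ← mul_assoc, ← add_mul, mul_comm Complex.I,
      Complex.re_add_im]
  simp only [split _ (u _), split _ (v _), hdre, hdim]
  rw [integral_add (integrable_iteratedDeriv_smul hre hsre k h.1)
      ((integrable_iteratedDeriv_smul him hsim k h.1).const_mul _), integral_const_mul,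
    h.2.2 _ hre hsre, h.2.2 _ him hsim, integral_add (integrable_test_smul hre hsre h.2.1)
      ((integrable_test_smul him hsim h.2.1).const_mul _), integral_const_mul]
  ring

theorem isWeakDeriv_iff {k : ℕ} :
    IsWeakDeriv k u v ↔ LocallyIntegrable u ∧ LocallyIntegrable v ∧
      ∀ φ, IsTestFun φ → ∫ x, iteratedDeriv k φ x * u x = (-1) ^ k * ∫ x, φ x * v x := by
  refine ⟨fun h => ⟨h.1, h.2.1, fun φ hφ => h.integral_iteratedDeriv_mul hφ⟩,
    fun ⟨hu, hv, h⟩ => ⟨hu, hv, fun φ hφ hs => ?_⟩⟩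
  have hk : ContDiff ℝ k φ := hφ.of_le (mod_cast le_top)
  have hd (x : ℝ) : iteratedDeriv k (fun y => (φ y : ℂ)) x = ((iteratedDeriv k φ x : ℝ) : ℂ) :=
    iteratedDeriv_clm_comp Complex.ofRealCLM hk x
  simpa only [hd, Complex.real_smul] using h _ (isTestFun_ofReal hφ hs)

theorem isWeakDeriv_one_iff :
    IsWeakDeriv 1 u v ↔ LocallyIntegrable u ∧ LocallyIntegrable v ∧
      ∀ φ, IsTestFun φ → ∫ x, deriv φ x * u x = -∫ x, φ x * v x := by
  simp only [isWeakDeriv_iff, iteratedDeriv_one, pow_one, neg_one_mul]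

theorem isWeakDeriv_two_iff :
    IsWeakDeriv 2 u v ↔ LocallyIntegrable u ∧ LocallyIntegrable v ∧
      ∀ φ, IsTestFun φ → ∫ x, deriv (deriv φ) x * u x = ∫ x, φ x * v x := by
  simp only [isWeakDeriv_iff, iteratedDeriv_succ, iteratedDeriv_zero, neg_one_sq, one_mul]

theorem isWeakDeriv_self (hu : LocallyIntegrable u) : IsWeakDeriv 0 u u :=
  ⟨hu, hu, fun φ _ _ => by simp⟩

theorem IsWeakDeriv.trans (h : IsWeakDeriv 1 u v) (h' : IsWeakDeriv 1 v w) :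
    IsWeakDeriv 2 u w := by
  rw [isWeakDeriv_one_iff] at h h'
  refine isWeakDeriv_two_iff.2 ⟨h.1, h'.2.1, fun φ hφ => ?_⟩
  rw [h.2.2 _ hφ.deriv, h'.2.2 φ hφ, neg_neg]

theorem IsWeakDeriv.of_two (h : IsWeakDeriv 1 u v) (h' : IsWeakDeriv 2 u w) :
    IsWeakDeriv 1 v w := by
  rw [isWeakDeriv_one_iff] at h ⊢
  rw [isWeakDeriv_two_iff] at h'
  refine ⟨h.2.1, h'.2.1, fun φ hφ => ?_⟩
  rw [← h'.2.2 φ hφ, h.2.2 _ hφ.deriv, neg_neg]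

end TestFunctions

/-! ### Exponential weights -/

section Weights

variable {u v w : ℝ → ℂ}

theorem weighted_weighted (q r : ℝ) (u : ℝ → ℂ) :
    weighted q (weighted r u) = weighted (q + r) u := by
  ext x
  simp only [weighted, ← mul_assoc, ← Complex.exp_add]
  congr 2
  push_cast
  ring

theorem weighted_neg_weighted (q : ℝ) (u : ℝ → ℂ) : weighted (-q) (weighted q u) = u := by
  ext x
  rw [weighted_weighted]
  simp [weighted]

theorem norm_weighted (q : ℝ) (u : ℝ → ℂ) (x : ℝ) :
    ‖weighted q u x‖ = Real.exp (-(q * x)) * ‖u x‖ := by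
  rw [weighted, norm_mul, ← Complex.ofReal_neg, Complex.norm_exp_ofReal]

theorem locallyIntegrable_weighted (hu : LocallyIntegrable u) (q : ℝ) :
    LocallyIntegrable (weighted q u) :=
  hu.continuous_mul (g := fun x : ℝ => Complex.exp (-(q * x : ℝ))) (by fun_prop)

theorem contDiff_cexp_mul (z : ℂ) : ContDiff ℝ ∞ fun x : ℝ => Complex.exp (z * x) :=
  (contDiff_const.mul Complex.ofRealCLM.contDiff).cexp

theorem hasDerivAt_cexp_mul (z : ℂ) (x : ℝ) :
    HasDerivAt (fun y : ℝ => Complex.exp (z * y)) (z * Complex.exp (z * x)) x := by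
  simpa [mul_comm z] using (((Complex.ofRealCLM.hasDerivAt (x := x)).const_mul z).cexp)

theorem IsWeakDeriv.weighted (h : IsWeakDeriv 1 u v) (q : ℝ) :
    IsWeakDeriv 1 (weighted q u) (weighted q (v + (-q : ℂ) • u)) := by
  rw [isWeakDeriv_one_iff] at h ⊢
  refine ⟨locallyIntegrable_weighted h.1 q,
    locallyIntegrable_weighted (h.2.1.add (h.1.smul (-q : ℂ))) q, fun φ hφ => ?_⟩
  set e : ℝ → ℂ := fun x => Complex.exp ((-q : ℂ) * x) with he
  have hφe : IsTestFun fun x => φ x * e x := hφ.mul_contDiff (contDiff_cexp_mul _)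
  have hd (x : ℝ) : deriv (fun x => φ x * e x) x = deriv φ x * e x + -q * (φ x * e x) := by
    refine ((hasDerivAt_of_contDiff hφ.contDiff x).mul (hasDerivAt_cexp_mul _ x)).deriv.trans ?_
    ring
  have hw (f : ℝ → ℂ) (x : ℝ) : AdvanceDelay.weighted q f x = e x * f x := by
    simp [AdvanceDelay.weighted, he]
  calc ∫ x, deriv φ x * AdvanceDelay.weighted q u x
      = (∫ x, deriv (fun x => φ x * e x) x * u x) + q * ∫ x, φ x * e x * u x := by
        rw [← integral_const_mul, ← integral_add (hφe.deriv.integrable_mul h.1)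
          ((hφe.integrable_mul h.1).const_mul _)]
        congr 1 with x
        rw [hd, hw]
        ring
    _ = -((∫ x, φ x * e x * v x) + -q * ∫ x, φ x * e x * u x) := by
        rw [h.2.2 _ hφe]
        ring
    _ = -∫ x, φ x * AdvanceDelay.weighted q (v + (-q : ℂ) • u) x := by
        rw [← integral_const_mul, ← integral_add (hφe.integrable_mul h.2.1)
          ((hφe.integrable_mul h.1).const_mul _)]
        congr 2 with x
        rw [hw, Pi.add_apply, Pi.smul_apply, smul_eq_mul]
        ring

theorem IsWeakDeriv.weighted_two (h : IsWeakDeriv 1 u v) (h' : IsWeakDeriv 1 v w) (q : ℝ) :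
    IsWeakDeriv 2 (AdvanceDelay.weighted q u)
      (AdvanceDelay.weighted q (w + (-q : ℂ) • v + (-q : ℂ) • (v + (-q : ℂ) • u))) :=
  (h.weighted q).trans ((h'.add (h.const_smul (-q : ℂ))).weighted q)

end Weights

/-! ### Exponentially bounded functions -/

/-- `f` is almost everywhere strongly measurable with `‖f x‖ ≤ M e^{q x}` almost everywhere,
that is, `f` represents an element of `L_q^∞` of norm at most `M`. -/
def ExpBdd (q M : ℝ) (f : ℝ → ℂ) : Prop :=
  AEStronglyMeasurable f volume ∧ ∀ᵐ x : ℝ, ‖f x‖ ≤ M * Real.exp (q * x)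

section ExpBdd

variable {q M N : ℝ} {f g : ℝ → ℂ}

theorem ExpBdd.nonneg (h : ExpBdd q M f) : 0 ≤ M := by
  obtain ⟨x, hx⟩ := h.2.exists
  exact nonneg_of_mul_nonneg_left ((norm_nonneg _).trans hx) (Real.exp_pos _)

theorem ExpBdd.congr (h : ExpBdd q M f) (hfg : f =ᵐ[volume] g) : ExpBdd q M g :=
  ⟨h.1.congr hfg, by filter_upwards [h.2, hfg] with x h1 h2; rwa [← h2]⟩

theorem ExpBdd.mono (h : ExpBdd q M f) (hMN : M ≤ N) : ExpBdd q N f :=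
  ⟨h.1, h.2.mono fun x hx => hx.trans (by gcongr)⟩

theorem ExpBdd.add (hf : ExpBdd q M f) (hg : ExpBdd q N g) : ExpBdd q (M + N) (f + g) :=
  ⟨hf.1.add hg.1, by
    filter_upwards [hf.2, hg.2] with x h1 h2
    exact (norm_add_le _ _).trans (by linarith)⟩

theorem ExpBdd.const_smul (hf : ExpBdd q M f) (a : ℂ) : ExpBdd q (‖a‖ * M) (a • f) :=
  ⟨hf.1.const_smul a, by
    filter_upwards [hf.2] with x h1
    rw [Pi.smul_apply, norm_smul, mul_assoc]
    gcongr⟩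

theorem ExpBdd.comp_add_right (hf : ExpBdd q M f) (d : ℝ) :
    ExpBdd q (Real.exp (q * d) * M) fun x => f (x + d) := by
  have hmp := (measurePreserving_add_right (volume : Measure ℝ) d).quasiMeasurePreserving
  refine ⟨hf.1.comp_quasiMeasurePreserving hmp, ?_⟩
  filter_upwards [hmp.ae hf.2] with x hx
  refine hx.trans_eq ?_
  rw [mul_add, Real.exp_add]
  ring

theorem ExpBdd.locallyIntegrable (hf : ExpBdd q M f) : LocallyIntegrable f := by
  have hc : Continuous fun x : ℝ => M * Real.exp (q * x) := by fun_prop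
  refine hc.locallyIntegrable.mono hf.1 ?_
  filter_upwards [hf.2] with x hx
  exact hx.trans (le_abs_self _)

theorem ExpBdd.weighted (hf : ExpBdd q M f) (r : ℝ) :
    ExpBdd (q - r) M (AdvanceDelay.weighted r f) := by
  refine ⟨(Continuous.aestronglyMeasurable (by fun_prop)).mul hf.1, ?_⟩
  filter_upwards [hf.2] with x hx
  rw [norm_weighted]
  calc Real.exp (-(r * x)) * ‖f x‖ ≤ Real.exp (-(r * x)) * (M * Real.exp (q * x)) := by gcongr
    _ = M * Real.exp ((q - r) * x) := by
      rw [mul_left_comm, ← Real.exp_add]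
      ring_nf

theorem ExpBdd.weighted_self (hf : ExpBdd q M f) : ExpBdd 0 M (AdvanceDelay.weighted q f) := by
  simpa using hf.weighted q

theorem ExpBdd.exists_Lp (hf : ExpBdd 0 M f) :
    ∃ v : Lp ℂ ∞ (volume : Measure ℝ), (v : ℝ → ℂ) =ᵐ[volume] f := by
  have h : MemLp f ∞ := memLp_top_of_bound hf.1 M (by simpa using hf.2)
  exact ⟨h.toLp f, h.coeFn_toLp⟩

end ExpBdd

/-! ### Membership and norms in the weighted spaces -/

section WeightedSpaces

variable {q M : ℝ} {r : ℕ}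

theorem shift_coe (d : ℝ) (f : ℝ →ₘ[volume] ℂ) :
    (shift d f : ℝ → ℂ) =ᵐ[volume] fun x => f (x + d) :=
  f.coeFn_compMeasurePreserving _

theorem Lp_top_ae_norm_le (v : Lp ℂ ∞ (volume : Measure ℝ)) : ∀ᵐ x, ‖v x‖ ≤ ‖v‖ := by
  filter_upwards [ae_le_eLpNormEssSup (f := (v : ℝ → ℂ)) (μ := volume)] with x hx
  rw [← eLpNorm_exponent_top] at hx
  simpa only [Lp.norm_def, toReal_enorm] using ENNReal.toReal_mono (Lp.eLpNorm_ne_top v) hx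

theorem Lp_top_norm_le {v : Lp ℂ ∞ (volume : Measure ℝ)} (hM : 0 ≤ M) (h : ∀ᵐ x, ‖v x‖ ≤ M) :
    ‖v‖ ≤ M := by
  rw [Lp.norm_def, eLpNorm_exponent_top]
  exact ENNReal.toReal_le_of_le_ofReal hM (eLpNormEssSup_le_of_ae_bound h)

theorem norm_wderiv_le (f : WInf q r) (j : Fin (r + 1)) {v : ℝ → ℂ}
    (hv : IsWeakDeriv j (weighted q f) v) (hb : ExpBdd 0 M v) : ‖wderiv f j‖ ≤ M := by
  refine Lp_top_norm_le hb.nonneg ?_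
  filter_upwards [(wderiv_spec f j).unique hv, hb.2] with x h1 h2
  rw [h1]
  simpa using h2

theorem wderiv_zero_ae (f : WInf q r) : (wderiv f 0 : ℝ → ℂ) =ᵐ[volume] weighted q f :=
  (wderiv_spec f 0).unique (isWeakDeriv_self (wderiv_spec f 0).1)

theorem norm_wderiv_le_norm (f : WInf q r) (j : Fin (r + 1)) : ‖wderiv f j‖ ≤ ‖f‖ := by
  rw [norm_def]
  exact Finset.single_le_sum (f := fun j => ‖wderiv f j‖) (fun i _ => norm_nonneg _)
    (Finset.mem_univ j)

theorem expBdd_wderiv (f : WInf q r) (j : Fin (r + 1)) : ExpBdd 0 ‖f‖ (wderiv f j) :=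
  ⟨Lp.aestronglyMeasurable _, by
    filter_upwards [Lp_top_ae_norm_le (wderiv f j)] with x hx
    simpa using hx.trans (norm_wderiv_le_norm f j)⟩

theorem expBdd_coe (f : WInf q r) : ExpBdd q ‖f‖ f := by
  simpa [weighted_neg_weighted] using
    ((expBdd_wderiv f 0).congr (wderiv_zero_ae f)).weighted (-q)

theorem mem_LInf {f : ℝ →ₘ[volume] ℂ} (hf : ExpBdd q M f) : f ∈ LInf q := by
  refine ⟨hf.locallyIntegrable, fun j => ?_⟩
  obtain ⟨v, hv⟩ := hf.weighted_self.exists_Lp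
  refine ⟨v, ?_⟩
  rw [Fin.val_eq_zero j]
  exact (isWeakDeriv_self hf.weighted_self.locallyIntegrable).congr (ae_eq_refl _) hv.symm

theorem norm_LInf_le (f : LInf q) (hf : ExpBdd q M f) : ‖f‖ ≤ M := by
  rw [norm_def, Fin.sum_univ_one]
  exact norm_wderiv_le f 0 (isWeakDeriv_self hf.weighted_self.locallyIntegrable)
    hf.weighted_self

variable {M₀ M₁ M₂ : ℝ} {f₁ f₂ : ℝ → ℂ}

theorem exists_isWeakDeriv_weighted {f : ℝ → ℂ} (hq : |q| ≤ 1) (hf : ExpBdd q M₀ f)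
    (h₁ : ExpBdd q M₁ f₁) (h₂ : ExpBdd q M₂ f₂) (hd₁ : IsWeakDeriv 1 f f₁)
    (hd₂ : IsWeakDeriv 1 f₁ f₂) (j : Fin (2 + 1)) :
    ∃ v, IsWeakDeriv j (weighted q f) v ∧ ExpBdd 0 (M₂ + 2 * M₁ + M₀) v := by
  have hM₀ := hf.nonneg
  have hM₁ := h₁.nonneg
  have hM₂ := h₂.nonneg
  have nq : ‖(-q : ℂ)‖ ≤ 1 := by simpa using hq
  have b1 : ExpBdd q (M₁ + M₀) (f₁ + (-q : ℂ) • f) :=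
    (h₁.add (hf.const_smul (-q : ℂ))).mono (by nlinarith)
  match j with
  | 0 => exact ⟨_, isWeakDeriv_self hf.weighted_self.locallyIntegrable,
      hf.weighted_self.mono (by linarith)⟩
  | 1 => exact ⟨_, hd₁.weighted q, b1.weighted_self.mono (by linarith)⟩
  | 2 => exact ⟨_, hd₁.weighted_two hd₂ q,
      ((h₂.add (h₁.const_smul (-q : ℂ))).add (b1.const_smul (-q : ℂ))).weighted_self.mono
        (by nlinarith)⟩

theorem mem_WInf_two {f : ℝ →ₘ[volume] ℂ} (hq : |q| ≤ 1) (hf : ExpBdd q M₀ f)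
    (h₁ : ExpBdd q M₁ f₁) (h₂ : ExpBdd q M₂ f₂) (hd₁ : IsWeakDeriv 1 f f₁)
    (hd₂ : IsWeakDeriv 1 f₁ f₂) : f ∈ WInf q 2 := by
  refine ⟨hf.locallyIntegrable, fun j => ?_⟩
  obtain ⟨v, hv, hb⟩ := exists_isWeakDeriv_weighted hq hf h₁ h₂ hd₁ hd₂ j
  obtain ⟨w, hw⟩ := hb.exists_Lp
  exact ⟨w, hv.congr (ae_eq_refl _) hw.symm⟩

theorem norm_WInf_two_le (hq : |q| ≤ 1) (f : WInf q 2) (hf : ExpBdd q M₀ f)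
    (h₁ : ExpBdd q M₁ f₁) (h₂ : ExpBdd q M₂ f₂) (hd₁ : IsWeakDeriv 1 f f₁)
    (hd₂ : IsWeakDeriv 1 f₁ f₂) : ‖f‖ ≤ 3 * (M₂ + 2 * M₁ + M₀) := by
  have h (j : Fin (2 + 1)) : ‖wderiv f j‖ ≤ M₂ + 2 * M₁ + M₀ := by
    obtain ⟨v, hv, hb⟩ := exists_isWeakDeriv_weighted hq hf h₁ h₂ hd₁ hd₂ j
    exact norm_wderiv_le f j hv hb
  rw [norm_def, Fin.sum_univ_three]
  linarith [h 0, h 1, h 2]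

theorem exists_isWeakDeriv_expBdd (hq : |q| ≤ 1) (f : WInf q 2) :
    ∃ f₁ f₂ : ℝ → ℂ, IsWeakDeriv 1 f f₁ ∧ IsWeakDeriv 1 f₁ f₂ ∧
      ExpBdd q (2 * ‖f‖) f₁ ∧ ExpBdd q (4 * ‖f‖) f₂ := by
  have h₀ := (expBdd_wderiv f 0).congr (wderiv_zero_ae f)
  have h₁ := expBdd_wderiv f 1
  have hd₁ := IsWeakDeriv.weighted (wderiv_spec f 1) (-q)
  have hd₂ := IsWeakDeriv.weighted_two (wderiv_spec f 1)
    ((wderiv_spec f 1).of_two (wderiv_spec f 2)) (-q)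
  have hb₁ := h₁.add (h₀.const_smul (-((-q : ℝ) : ℂ)))
  have hb₂ := ((expBdd_wderiv f 2).add (h₁.const_smul (-((-q : ℝ) : ℂ)))).add
    (hb₁.const_smul (-((-q : ℝ) : ℂ)))
  rw [weighted_neg_weighted] at hd₁ hd₂
  have nq : ‖(-((-q : ℝ) : ℂ))‖ ≤ 1 := by simpa using hq
  have hle := mul_le_of_le_one_left (norm_nonneg f) nq
  have hle' := mul_le_of_le_one_left hb₁.nonneg nq
  refine ⟨_, _, hd₁, hd₁.of_two hd₂, ?_, ?_⟩
  · simpa using (hb₁.weighted (-q)).mono (N := 2 * ‖f‖) (by linarith)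
  · simpa using (hb₂.weighted (-q)).mono (N := 4 * ‖f‖) (by linarith)

end WeightedSpaces

/-! ### Convolution with exponentially decaying kernels -/

/-- The convolution `(K * h)(x) = ∫ K(x - s) h(s) ds`. The transposed operator is the convolution
with the reflected kernel `fun y => K (-y)`. -/
def convK (K h : ℝ → ℂ) (x : ℝ) : ℂ := ∫ s, K (x - s) * h s

/-- `K` is a measurable kernel with `‖K y‖ ≤ A e^{q y - m |y|}`; for `m > 0` convolution with `K`
is then bounded on `L_q^∞`. -/
def KerBdd (q m A : ℝ) (K : ℝ → ℂ) : Prop :=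
  Measurable K ∧ ∀ y, ‖K y‖ ≤ A * Real.exp (q * y - m * |y|)

section Convolution

variable {q m A M : ℝ} {K h φ : ℝ → ℂ}

theorem convK_eq_convolution (K h : ℝ → ℂ) :
    convK K h = convolution K h (ContinuousLinearMap.mul ℝ ℂ) volume := by
  ext x
  rw [convolution_eq_swap]
  rfl

theorem contDiff_convK (hK : LocallyIntegrable K) (hφ : IsTestFun φ) :
    ContDiff ℝ ∞ (convK K φ) := by
  rw [convK_eq_convolution]
  exact hφ.hasCompactSupport.contDiff_convolution_right _ hK hφ.contDiff

theorem deriv_convK (hK : LocallyIntegrable K) (hφ : IsTestFun φ) :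
    deriv (convK K φ) = convK K (deriv φ) := by
  ext x
  rw [convK_eq_convolution, convK_eq_convolution]
  exact (hφ.hasCompactSupport.hasDerivAt_convolution_right _ hK
    (hφ.contDiff.of_le (by exact_mod_cast le_top)) x).deriv

theorem isTestFun_convK (hK : LocallyIntegrable K) (hs : HasCompactSupport K) (hφ : IsTestFun φ) :
    IsTestFun (convK K φ) := by
  refine ⟨contDiff_convK hK hφ, ?_⟩
  rw [convK_eq_convolution]
  exact hs.convolution _ hφ.hasCompactSupport

theorem integrable_conv (hK : LocallyIntegrable K) (hφ : IsTestFun φ) (x : ℝ) :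
    Integrable fun s => K (x - s) * φ s :=
  (hφ.hasCompactSupport.convolutionExists_right (ContinuousLinearMap.mul ℝ ℂ) hK
    hφ.continuous x).integrable_swap

theorem convK_comp_add (K φ : ℝ → ℂ) (d x : ℝ) :
    convK K (fun s => φ (s + d)) x = convK K φ (x + d) := by
  rw [convK, convK, ← integral_add_right_eq_self (fun s => K (x + d - s) * φ s) d]
  simp only [add_sub_add_right_eq_sub]

theorem integral_exp_neg_mul_abs (hm : 0 < m) : ∫ y : ℝ, Real.exp (-(m * |y|)) = 2 / m := by
  rw [integral_comp_abs (f := fun y : ℝ => Real.exp (-(m * y)))]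
  have := integral_exp_mul_Ioi (neg_neg_of_pos hm) 0
  simp only [neg_mul] at this
  rw [this]
  simp [div_eq_mul_inv]

theorem integrable_exp_neg_mul_abs (hm : 0 < m) :
    Integrable fun y : ℝ => Real.exp (-(m * |y|)) := by
  refine not_imp_comm.1 integral_undef ?_
  rw [integral_exp_neg_mul_abs hm]
  positivity

theorem KerBdd.nonneg (hK : KerBdd q m A K) : 0 ≤ A := by
  simpa using (norm_nonneg _).trans (hK.2 0)

theorem KerBdd.locallyIntegrable (hK : KerBdd q m A K) : LocallyIntegrable K := by
  have hc : Continuous fun y : ℝ => A * Real.exp (q * y - m * |y|) := by fun_prop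
  refine hc.locallyIntegrable.mono hK.1.aestronglyMeasurable (Eventually.of_forall fun y => ?_)
  exact (hK.2 y).trans (le_abs_self _)

theorem KerBdd.comp_neg (hK : KerBdd q m A K) : KerBdd (-q) m A fun y => K (-y) :=
  ⟨hK.1.comp measurable_neg, fun y => by simpa using hK.2 (-y)⟩

theorem KerBdd.norm_mul_le (hK : KerBdd q m A K) {a : ℂ} {x s : ℝ}
    (ha : ‖a‖ ≤ M * Real.exp (q * s)) :
    ‖K (x - s) * a‖ ≤ A * M * Real.exp (q * x) * Real.exp (-(m * |x - s|)) := by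
  have hA := hK.nonneg
  calc ‖K (x - s) * a‖
      ≤ (A * Real.exp (q * (x - s) - m * |x - s|)) * (M * Real.exp (q * s)) := by
        rw [norm_mul]
        gcongr
        exact hK.2 _
    _ = A * M * (Real.exp (q * (x - s) - m * |x - s|) * Real.exp (q * s)) := by ring
    _ = A * M * (Real.exp (q * x) * Real.exp (-(m * |x - s|))) := by
        rw [← Real.exp_add, ← Real.exp_add]
        ring_nf
    _ = _ := by ring

theorem KerBdd.aestronglyMeasurable_prod (hK : KerBdd q m A K) (hh : AEStronglyMeasurable h) :
    AEStronglyMeasurable (fun p : ℝ × ℝ => K (p.1 - p.2) * h p.2)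
      ((volume : Measure ℝ).prod volume) :=
  (hK.1.comp (measurable_fst.sub measurable_snd)).aestronglyMeasurable.mul
    (hh.comp_quasiMeasurePreserving Measure.quasiMeasurePreserving_snd)

theorem KerBdd.integrable_conv (hK : KerBdd q m A K) (hm : 0 < m) (hh : ExpBdd q M h) (x : ℝ) :
    Integrable fun s => K (x - s) * h s := by
  have hi := ((integrable_exp_neg_mul_abs hm).comp_sub_left x).const_mul
    (A * M * Real.exp (q * x))
  refine hi.mono' ?_ ?_
  · exact (hK.1.comp (measurable_const.sub measurable_id)).aestronglyMeasurable.mul hh.1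
  · filter_upwards [hh.2] with s hs
    exact hK.norm_mul_le hs

theorem KerBdd.integral_norm_conv_le (hK : KerBdd q m A K) (hm : 0 < m) (hh : ExpBdd q M h)
    (x : ℝ) : ∫ s, ‖K (x - s) * h s‖ ≤ A * M * (2 / m) * Real.exp (q * x) := by
  have hi := ((integrable_exp_neg_mul_abs hm).comp_sub_left x).const_mul
    (A * M * Real.exp (q * x))
  calc ∫ s, ‖K (x - s) * h s‖
      ≤ ∫ s, A * M * Real.exp (q * x) * Real.exp (-(m * |x - s|)) := by
        refine integral_mono_ae (hK.integrable_conv hm hh x).norm hi ?_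
        filter_upwards [hh.2] with s hs
        exact hK.norm_mul_le hs
    _ = _ := by
        rw [integral_const_mul, integral_sub_left_eq_self (fun y => Real.exp (-(m * |y|))),
          integral_exp_neg_mul_abs hm]
        ring

theorem KerBdd.expBdd_convK (hK : KerBdd q m A K) (hm : 0 < m) (hh : ExpBdd q M h) :
    ExpBdd q (A * M * (2 / m)) (convK K h) :=
  ⟨(hK.aestronglyMeasurable_prod hh.1).integral_prod_right', Eventually.of_forall fun x =>
    (norm_integral_le_integral_norm _).trans (hK.integral_norm_conv_le hm hh x)⟩

theorem KerBdd.integrable_prod (hK : KerBdd q m A K) (hm : 0 < m) (hh : ExpBdd q M h)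
    (hφ : IsTestFun φ) :
    Integrable (fun p : ℝ × ℝ => φ p.1 * (K (p.1 - p.2) * h p.2))
      ((volume : Measure ℝ).prod volume) := by
  have hφc := hφ.continuous
  have hmeas : AEStronglyMeasurable (fun p : ℝ × ℝ => φ p.1 * (K (p.1 - p.2) * h p.2))
      ((volume : Measure ℝ).prod volume) :=
    (hφc.comp continuous_fst).aestronglyMeasurable.mul (hK.aestronglyMeasurable_prod hh.1)
  rw [integrable_prod_iff hmeas]
  refine ⟨Eventually.of_forall fun x => (hK.integrable_conv hm hh x).const_mul (φ x), ?_⟩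
  have hb : Integrable fun x : ℝ => ‖φ x‖ * (A * M * (2 / m) * Real.exp (q * x)) :=
    Continuous.integrable_of_hasCompactSupport (by fun_prop) hφ.hasCompactSupport.norm.mul_right
  refine hb.mono' hmeas.norm.integral_prod_right' (Eventually.of_forall fun x => ?_)
  rw [Real.norm_of_nonneg (integral_nonneg fun _ => norm_nonneg _)]
  simp only [norm_mul (φ x)]
  rw [integral_const_mul]
  exact mul_le_mul_of_nonneg_left (hK.integral_norm_conv_le hm hh x) (norm_nonneg _)

theorem integral_mul_kernel_mul (K φ h : ℝ → ℂ) (s : ℝ) :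
    ∫ x, φ x * (K (x - s) * h s) = convK (fun y => K (-y)) φ s * h s := by
  rw [convK, ← integral_mul_const]
  congr 1 with x
  rw [neg_sub]
  ring

theorem KerBdd.integrable_convK_neg_mul (hK : KerBdd q m A K) (hm : 0 < m) (hh : ExpBdd q M h)
    (hφ : IsTestFun φ) : Integrable fun s => convK (fun y => K (-y)) φ s * h s := by
  simpa only [integral_mul_kernel_mul] using (hK.integrable_prod hm hh hφ).integral_prod_right

theorem KerBdd.integral_mul_convK (hK : KerBdd q m A K) (hm : 0 < m) (hh : ExpBdd q M h)
    (hφ : IsTestFun φ) :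
    ∫ x, φ x * convK K h x = ∫ s, convK (fun y => K (-y)) φ s * h s := by
  have := integral_integral_swap (f := fun x s => φ x * (K (x - s) * h s))
    (hK.integrable_prod hm hh hφ)
  simpa only [integral_mul_kernel_mul, integral_const_mul, convK] using this

end Convolution

/-! ### Landau's inequality -/

/-- The kernel `(1 - y) 1_{[0,1]}(y)` of the remainder in Taylor's formula of second order. -/
def taylorKer (y : ℝ) : ℂ := (Set.Icc (0 : ℝ) 1).indicator (fun y => ((1 - y : ℝ) : ℂ)) y

section Landau

variable {q M₀ M₂ : ℝ} {f f₂ φ : ℝ → ℂ}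

theorem exp_le_three {x : ℝ} (hx : x ≤ 1) : Real.exp x ≤ 3 :=
  (Real.exp_le_exp.2 hx).trans (Real.exp_one_lt_d9.le.trans (by norm_num))

theorem kerBdd_taylorKer (hq : |q| ≤ 1) : KerBdd q 1 9 taylorKer := by
  refine ⟨Measurable.indicator (by fun_prop) measurableSet_Icc, fun y => ?_⟩
  by_cases hy : y ∈ Set.Icc (0 : ℝ) 1
  · have hexp : 1 ≤ Real.exp 1 * Real.exp 1 * Real.exp (q * y - 1 * |y|) := by
      rw [← Real.exp_add, ← Real.exp_add, abs_of_nonneg hy.1]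
      refine Real.one_le_exp ?_
      nlinarith [hy.1, hy.2, (abs_le.1 hq).1]
    rw [taylorKer, Set.indicator_of_mem hy, Complex.norm_real, Real.norm_eq_abs,
      abs_of_nonneg (by linarith [hy.2])]
    calc 1 - y ≤ 1 := by linarith [hy.1]
      _ ≤ Real.exp 1 * Real.exp 1 * Real.exp (q * y - 1 * |y|) := hexp
      _ ≤ 3 * 3 * Real.exp (q * y - 1 * |y|) := by gcongr <;> exact exp_le_three le_rfl
      _ = 9 * Real.exp (q * y - 1 * |y|) := by norm_num
  · rw [taylorKer, Set.indicator_of_notMem hy, norm_zero]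
    positivity

theorem hasCompactSupport_taylorKer : HasCompactSupport taylorKer :=
  HasCompactSupport.intro (isCompact_Icc (a := 0) (b := 1)) fun _ hy =>
    Set.indicator_of_notMem hy _

theorem convK_taylorKer_neg (φ : ℝ → ℂ) (s : ℝ) :
    convK (fun y => taylorKer (-y)) φ s = ∫ y in (0 : ℝ)..1, ((1 - y : ℝ) : ℂ) * φ (y + s) := by
  rw [convK, ← integral_add_right_eq_self _ s, intervalIntegral.integral_of_le zero_le_one,
    ← integral_Icc_eq_integral_Ioc, ← integral_indicator measurableSet_Icc]
  congr 1 with y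
  simp only [neg_sub, add_sub_cancel_right, taylorKer, Set.indicator_mul_left]

theorem convK_taylorKer_neg_deriv_deriv (hφ : IsTestFun φ) (s : ℝ) :
    convK (fun y => taylorKer (-y)) (deriv (deriv φ)) s =
      φ (s + 1) - φ s - deriv φ s := by
  have hshift {ψ : ℝ → ℂ} (hψ : IsTestFun ψ) (y : ℝ) :
      HasDerivAt (fun y => ψ (y + s)) (deriv ψ (y + s)) y :=
    (hasDerivAt_of_contDiff hψ.contDiff _).comp_add_const y s
  have hprim (y : ℝ) : HasDerivAt
      (fun y : ℝ => ((1 - y : ℝ) : ℂ) * deriv φ (y + s) + φ (y + s))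
      (((1 - y : ℝ) : ℂ) * deriv (deriv φ) (y + s)) y := by
    have hlin : HasDerivAt (fun y : ℝ => ((1 - y : ℝ) : ℂ)) ((-1 : ℝ) : ℂ) y :=
      ((hasDerivAt_id y).const_sub 1).ofReal_comp
    refine ((hlin.mul (hshift hφ.deriv y)).add (hshift hφ y)).congr_deriv ?_
    push_cast
    ring
  have hcont := hφ.deriv.deriv.continuous
  rw [convK_taylorKer_neg, intervalIntegral.integral_eq_sub_of_hasDerivAt (fun y _ => hprim y)
    (Continuous.intervalIntegrable (by fun_prop) _ _)]
  simp only [sub_self, Complex.ofReal_zero, zero_mul, zero_add, sub_zero, Complex.ofReal_one,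
    one_mul, add_comm 1 s]
  ring

theorem integral_comp_add_mul (φ f : ℝ → ℂ) (d : ℝ) :
    ∫ x, φ (x + d) * f x = ∫ x, φ x * f (x + -d) := by
  rw [← integral_add_right_eq_self (fun x => φ x * f (x + -d)) d]
  simp only [add_neg_cancel_right]

/-- Taylor's formula `f'(x) = f(x) - f(x - 1) + ∫₀¹ (1 - y) f''(x - y) dy`. -/
theorem IsWeakDeriv.one_of_two (hq : |q| ≤ 1) (h : IsWeakDeriv 2 f f₂) (hf : ExpBdd q M₀ f)
    (hf₂ : ExpBdd q M₂ f₂) :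
    IsWeakDeriv 1 f (f + (-1 : ℂ) • (fun x => f (x + -1)) + convK taylorKer f₂) := by
  have hK := kerBdd_taylorKer hq
  have hsh := (hf.comp_add_right (-1)).locallyIntegrable
  have hconv := (hK.expBdd_convK one_pos hf₂).locallyIntegrable
  refine isWeakDeriv_one_iff.2
    ⟨h.1, (h.1.add (hsh.smul (-1 : ℂ))).add hconv, fun φ hφ => ?_⟩
  have hR : LocallyIntegrable fun y => taylorKer (-y) := hK.comp_neg.locallyIntegrable
  have hψ : IsTestFun (convK (fun y => taylorKer (-y)) φ) :=
    isTestFun_convK hR (hasCompactSupport_taylorKer.comp_homeomorph (Homeomorph.neg ℝ)) hφ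
  have i₀ := hφ.integrable_mul h.1
  have i₁ := (hφ.comp_add_right 1).integrable_mul h.1
  have i₂ := hφ.deriv.integrable_mul h.1
  have i₃ := hφ.integrable_mul hsh
  have i₄ := hφ.integrable_mul hconv
  have hpair : (∫ x, φ x * f (x + -1)) - (∫ x, φ x * f x) - ∫ x, deriv φ x * f x =
      ∫ x, φ x * convK taylorKer f₂ x := by
    rw [← integral_comp_add_mul, hK.integral_mul_convK one_pos hf₂ hφ,
      ← (isWeakDeriv_two_iff.1 h).2.2 _ hψ, deriv_convK hR hφ, deriv_convK hR hφ.deriv,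
      ← integral_sub i₁ i₀, ← integral_sub (by exact i₁.sub i₀) i₂]
    congr 1 with x
    rw [convK_taylorKer_neg_deriv_deriv hφ]
    ring
  have hexpand : ∫ x, φ x * (f + (-1 : ℂ) • (fun x => f (x + -1)) + convK taylorKer f₂) x =
      (∫ x, φ x * f x) - (∫ x, φ x * f (x + -1)) + ∫ x, φ x * convK taylorKer f₂ x := by
    rw [← integral_sub i₀ i₃, ← integral_add (by exact i₀.sub i₃) i₄]
    congr 1 with x
    simp only [Pi.add_apply, Pi.smul_apply, smul_eq_mul]
    ring
  linear_combination hexpand - hpair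

theorem IsWeakDeriv.exists_one (hq : |q| ≤ 1) (h : IsWeakDeriv 2 f f₂) (hf : ExpBdd q M₀ f)
    (hf₂ : ExpBdd q M₂ f₂) :
    ∃ f₁, IsWeakDeriv 1 f f₁ ∧ ExpBdd q (4 * M₀ + 18 * M₂) f₁ := by
  refine ⟨_, h.one_of_two hq hf hf₂, ((hf.add ((hf.comp_add_right (-1)).const_smul (-1))).add
    ((kerBdd_taylorKer hq).expBdd_convK one_pos hf₂)).mono ?_⟩
  have hexp : Real.exp (q * -1) ≤ 3 := exp_le_three (by linarith [(abs_le.1 hq).1])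
  rw [norm_neg, norm_one]
  nlinarith [mul_le_mul_of_nonneg_right hexp hf.nonneg]

end Landau

/-! ### The operator and its Green's function -/

/-- `B_c f`, with `f₂` in the role of the second derivative of `f`, so that the same formula serves
functions differentiated classically and weakly. -/
def opB (c : ℝ) (f f₂ : ℝ → ℂ) (x : ℝ) : ℂ :=
  (c : ℂ) ^ 2 * f₂ x + 2 * f x + f (x + 1) + f (x + -1)

section Operator

variable {c q : ℝ} {φ f f₂ ψ ψ₂ K w : ℝ → ℂ}

theorem integral_opB_mul (c : ℝ) (h₂ : Integrable fun x => ψ₂ x * w x)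
    (h₀ : Integrable fun x => ψ x * w x) (hr : Integrable fun x => ψ (x + 1) * w x)
    (hl : Integrable fun x => ψ (x + -1) * w x) :
    ∫ x, opB c ψ ψ₂ x * w x = (c : ℂ) ^ 2 * (∫ x, ψ₂ x * w x) + 2 * (∫ x, ψ x * w x) +
      (∫ x, ψ (x + 1) * w x) + ∫ x, ψ (x + -1) * w x := by
  rw [← integral_const_mul, ← integral_const_mul,
    ← integral_add (h₂.const_mul _) (h₀.const_mul _),
    ← integral_add (by exact (h₂.const_mul _).add (h₀.const_mul _)) hr,
    ← integral_add (by exact ((h₂.const_mul _).add (h₀.const_mul _)).add hr) hl]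
  congr 1 with x
  rw [opB]
  ring

/-- The shift terms of `B_c` are symmetric, so only the second derivatives contribute. -/
theorem integral_opB_mul_sub (c : ℝ) (h₂ : Integrable fun x => ψ₂ x * f x)
    (h₀ : Integrable fun x => ψ x * f x) (hr : Integrable fun x => ψ (x + 1) * f x)
    (hl : Integrable fun x => ψ (x + -1) * f x) (h₂' : Integrable fun x => ψ x * f₂ x) :
    (∫ x, opB c ψ ψ₂ x * f x) - ∫ x, ψ x * opB c f f₂ x =
      (c : ℂ) ^ 2 * ((∫ x, ψ₂ x * f x) - ∫ x, ψ x * f₂ x) := by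
  have hr' : Integrable fun x => f (x + 1) * ψ x := by
    simpa [mul_comm] using hl.comp_add_right 1
  have hl' : Integrable fun x => f (x + -1) * ψ x := by
    simpa [mul_comm] using hr.comp_add_right (-1)
  have hadj := integral_opB_mul c (ψ₂ := f₂) (ψ := f) (w := ψ) (by simpa only [mul_comm] using h₂')
    (by simpa only [mul_comm] using h₀) hr' hl'
  rw [integral_comp_add_mul, integral_comp_add_mul, neg_neg] at hadj
  simp only [mul_comm (f _), mul_comm (f₂ _), mul_comm (opB c f f₂ _)] at hadj
  rw [integral_opB_mul c h₂ h₀ hr hl, hadj]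
  ring

theorem IsTestFun.integral_opB_mul_sub (hφ : IsTestFun φ) (c : ℝ) (hf : LocallyIntegrable f)
    (hf₂ : LocallyIntegrable f₂) :
    (∫ x, opB c φ (_root_.deriv (_root_.deriv φ)) x * f x) - ∫ x, φ x * opB c f f₂ x =
      (c : ℂ) ^ 2 * ((∫ x, _root_.deriv (_root_.deriv φ) x * f x) - ∫ x, φ x * f₂ x) :=
  AdvanceDelay.integral_opB_mul_sub c (hφ.deriv.deriv.integrable_mul hf) (hφ.integrable_mul hf)
    ((hφ.comp_add_right 1).integrable_mul hf) ((hφ.comp_add_right (-1)).integrable_mul hf)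
    (hφ.integrable_mul hf₂)

theorem IsWeakDeriv.integral_opB_mul (h : IsWeakDeriv 2 f f₂) (c : ℝ) (hφ : IsTestFun φ) :
    ∫ x, opB c φ (deriv (deriv φ)) x * f x = ∫ x, φ x * opB c f f₂ x := by
  rw [← sub_eq_zero, hφ.integral_opB_mul_sub c h.1 h.2.1, (isWeakDeriv_two_iff.1 h).2.2 φ hφ,
    sub_self, mul_zero]

theorem isTestFun_opB (c : ℝ) (hφ : IsTestFun φ) : IsTestFun (opB c φ (deriv (deriv φ))) where
  contDiff := (((contDiff_const.mul hφ.deriv.deriv.contDiff).add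
    (contDiff_const.mul hφ.contDiff)).add (hφ.comp_add_right 1).contDiff).add
    (hφ.comp_add_right (-1)).contDiff
  hasCompactSupport := ((hφ.deriv.deriv.hasCompactSupport.mul_left.add
    hφ.hasCompactSupport.mul_left).add (hφ.comp_add_right 1).hasCompactSupport).add
    (hφ.comp_add_right (-1)).hasCompactSupport

theorem opB_convK (c : ℝ) (hK : LocallyIntegrable K) (hφ : IsTestFun φ) :
    opB c (convK K φ) (convK K (deriv (deriv φ))) = convK K (opB c φ (deriv (deriv φ))) := by
  ext x
  have h₂ := (integrable_conv hK hφ.deriv.deriv x).const_mul ((c : ℂ) ^ 2)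
  have h₀ := (integrable_conv hK hφ x).const_mul 2
  have hr := integrable_conv hK (hφ.comp_add_right 1) x
  have hl := integrable_conv hK (hφ.comp_add_right (-1)) x
  rw [opB, ← convK_comp_add, ← convK_comp_add, convK, convK, convK, convK, convK,
    ← integral_const_mul, ← integral_const_mul, ← integral_add h₂ h₀,
    ← integral_add (by exact h₂.add h₀) hr, ← integral_add (by exact (h₂.add h₀).add hr) hl]
  congr 1 with s
  rw [opB]
  ring

theorem isWeakDeriv_of_hasDerivAt (h : ∀ x, HasDerivAt f (f₂ x) x) (hc : Continuous f₂) :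
    IsWeakDeriv 1 f f₂ := by
  have hf : LocallyIntegrable f :=
    (continuous_iff_continuousAt.2 fun x => (h x).continuousAt).locallyIntegrable
  have hf₂ : LocallyIntegrable f₂ := hc.locallyIntegrable
  refine isWeakDeriv_one_iff.2 ⟨hf, hf₂, fun φ hφ => ?_⟩
  rw [integral_mul_deriv_eq_deriv_mul_of_integrable
    (fun x _ => hasDerivAt_of_contDiff hφ.contDiff x) (fun x _ => h x) (hφ.integrable_mul hf₂)
    (hφ.deriv.integrable_mul hf) (hφ.integrable_mul hf), neg_neg]

theorem isWeakDeriv_two_cexp (y : ℝ) (z : ℂ) :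
    IsWeakDeriv 2 (fun s : ℝ => Complex.exp ((y - s : ℝ) * z))
      fun s : ℝ => z ^ 2 * Complex.exp ((y - s : ℝ) * z) := by
  have hd (a : ℂ) (s : ℝ) : HasDerivAt (fun s : ℝ => a * Complex.exp ((y - s : ℝ) * z))
      (-(a * z) * Complex.exp ((y - s : ℝ) * z)) s := by
    have hlin : HasDerivAt (fun s : ℝ => ((y - s : ℝ) : ℂ) * z) (((-1 : ℝ) : ℂ) * z) s :=
      (((hasDerivAt_id s).const_sub y).ofReal_comp).mul_const z
    refine (hlin.cexp.const_mul a).congr_deriv ?_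
    push_cast
    ring
  have h := (isWeakDeriv_of_hasDerivAt (hd 1) (by fun_prop)).trans
    (isWeakDeriv_of_hasDerivAt (hd _) (by fun_prop))
  simpa only [one_mul, neg_mul, neg_neg, ← sq] using h

theorem opB_cexp (c y : ℝ) (z : ℂ) (s : ℝ) :
    opB c (fun s : ℝ => Complex.exp ((y - s : ℝ) * z))
      (fun s : ℝ => z ^ 2 * Complex.exp ((y - s : ℝ) * z)) s =
      charFun c z * Complex.exp ((y - s : ℝ) * z) := by
  have hshift (d : ℝ) : Complex.exp ((y - (s + d) : ℝ) * z) =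
      Complex.exp (-(d * z)) * Complex.exp ((y - s : ℝ) * z) := by
    rw [← Complex.exp_add]
    push_cast
    ring_nf
  rw [opB, hshift, hshift, charFun, Complex.cosh]
  push_cast
  rw [one_mul, neg_one_mul, neg_neg]
  ring

theorem integral_opB_mul_cexp (c y : ℝ) (hφ : IsTestFun φ) (z : ℂ) :
    ∫ s : ℝ, opB c φ (deriv (deriv φ)) s * Complex.exp ((y - s : ℝ) * z) =
      charFun c z * ∫ s : ℝ, φ s * Complex.exp ((y - s : ℝ) * z) := by
  rw [(isWeakDeriv_two_cexp y z).integral_opB_mul c hφ, ← integral_const_mul]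
  simp only [opB_cexp, mul_left_comm (φ _)]

open FourierTransform in
theorem IsTestFun.integral_laplace_inversion (hφ : IsTestFun φ) (q y : ℝ) :
    ∫ t : ℝ, ∫ s : ℝ, φ s * Complex.exp ((y - s : ℝ) * vline q t) = 2 * Real.pi * φ y := by
  set F : ℝ → ℂ := fun s => φ s * Complex.exp ((y - s : ℝ) * q) with hF
  have hF_test : IsTestFun F := hφ.mul_contDiff <|
    ((Complex.ofRealCLM.contDiff.comp (contDiff_const.sub contDiff_id)).mul contDiff_const).cexp
  have hinv : 𝓕⁻ (𝓕 F) y = F y := by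
    have h := FourierPair.fourierInv_fourier_eq (F := SchwartzMap ℝ ℂ)
      (hF_test.hasCompactSupport.toSchwartzMap hF_test.contDiff)
    have hy := congrArg (fun f => f y) h
    rwa [SchwartzMap.fourierInv_coe, SchwartzMap.fourier_coe] at hy
  set H : ℝ → ℂ := fun t => ∫ s : ℝ, φ s * Complex.exp ((y - s : ℝ) * vline q t)
  have hscale : 𝓕⁻ (𝓕 F) y = ∫ ξ : ℝ, H (2 * Real.pi * ξ) := by
    rw [Real.fourierInv_eq']
    congr 1 with ξ
    rw [Real.fourier_eq', smul_eq_mul, ← integral_const_mul]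
    congr 1 with s
    simp only [hF, smul_eq_mul, vline]
    rw [mul_left_comm (Complex.exp _) (φ s), mul_left_comm (Complex.exp _) (φ s),
      ← Complex.exp_add, ← Complex.exp_add]
    congr 2
    simp only [RCLike.inner_apply, conj_trivial]
    push_cast
    ring
  have hFy : F y = φ y := by simp [hF]
  rw [hinv, hFy, Measure.integral_comp_mul_left, abs_inv, abs_of_pos (by positivity),
    Complex.real_smul] at hscale
  rw [hscale]
  push_cast
  field_simp

theorem IsTestFun.integrable_kernelK_mul (hφ : IsTestFun φ) (hc : 1 ≤ c) (hq : |q| ≤ 1 / 4)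
    (h0 : q ≠ 0) (y : ℝ) :
    Integrable (fun p : ℝ × ℝ => kernelK c (y - p.1) (vline q p.2) * φ p.1)
      ((volume : Measure ℝ).prod volume) := by
  have hφc := hφ.continuous
  have hbound : Integrable fun s : ℝ => ‖φ s‖ * (400 / |q| * Real.exp ((y - s) * q)) :=
    Continuous.integrable_of_hasCompactSupport (by fun_prop) hφ.hasCompactSupport.norm.mul_right
  refine (hbound.mul_prod (integrable_const_div_one_add_sq 1)).mono' ?_
    (Eventually.of_forall fun p => ?_)
  · have hcont : Continuous fun p : ℝ × ℝ => kernelK c (y - p.1) (vline q p.2) :=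
      (continuous_kernelK_vline hc hq h0).comp
        ((continuous_const.sub continuous_fst).prodMk continuous_snd)
    exact (hcont.mul (hφc.comp continuous_fst)).aestronglyMeasurable
  · calc ‖kernelK c (y - p.1) (vline q p.2) * φ p.1‖
        ≤ (400 / |q| * Real.exp ((y - p.1) * q)) / (1 + p.2 ^ 2) * ‖φ p.1‖ := by
          rw [norm_mul]
          gcongr
          exact norm_kernelK_vline_le hc hq h0 _ _
      _ = _ := by ring

theorem convK_green_opB (hc : 1 ≤ c) (hq : |q| ≤ 1 / 4) (h0 : q ≠ 0) (hφ : IsTestFun φ) :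
    convK (green c q) (opB c φ (deriv (deriv φ))) = φ := by
  ext y
  set χ := opB c φ (deriv (deriv φ))
  have hinner (t : ℝ) : ∫ s, kernelK c (y - s) (vline q t) * χ s =
      ∫ s : ℝ, φ s * Complex.exp ((y - s : ℝ) * vline q t) := by
    have hne := charFun_vline_ne_zero (t := t) hc hq h0
    rw [← mul_right_inj' hne, ← integral_opB_mul_cexp c y hφ, ← integral_const_mul]
    congr 1 with s
    rw [kernelK_eq]
    field_simp
    rfl
  calc convK (green c q) χ y
      = (2 * Real.pi : ℂ)⁻¹ * ∫ s, ∫ t, kernelK c (y - s) (vline q t) * χ s := by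
        rw [convK, ← integral_const_mul]
        congr 1 with s
        rw [green, contourIntegral_eq, integral_mul_const, mul_assoc]
    _ = (2 * Real.pi : ℂ)⁻¹ * ∫ t, ∫ s, kernelK c (y - s) (vline q t) * χ s := by
        rw [integral_integral_swap ((isTestFun_opB c hφ).integrable_kernelK_mul hc hq h0 y)]
    _ = φ y := by
        simp only [hinner]
        rw [hφ.integral_laplace_inversion]
        field_simp

end Operator

/-! ### Solvability of the equation -/

section Equation

variable {c q M : ℝ} {f f₂ g φ : ℝ → ℂ}

theorem isWeakDeriv_two_of_integral_opB (hc : c ≠ 0) (hf : LocallyIntegrable f)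
    (hf₂ : LocallyIntegrable f₂)
    (h : ∀ φ, IsTestFun φ → ∫ x, opB c φ (deriv (deriv φ)) x * f x = ∫ x, φ x * opB c f f₂ x) :
    IsWeakDeriv 2 f f₂ := by
  refine isWeakDeriv_two_iff.2 ⟨hf, hf₂, fun φ hφ => ?_⟩
  have hsub := hφ.integral_opB_mul_sub c hf hf₂
  rw [h φ hφ, sub_self, eq_comm, mul_eq_zero] at hsub
  exact sub_eq_zero.1 (hsub.resolve_left (pow_ne_zero 2 (Complex.ofReal_ne_zero.2 hc)))

theorem opB_congr_ae (c : ℝ) {f' f₂' : ℝ → ℂ} (hf : f =ᵐ[volume] f') (hf₂ : f₂ =ᵐ[volume] f₂') :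
    opB c f f₂ =ᵐ[volume] opB c f' f₂' := by
  have hshift (d : ℝ) : ∀ᵐ x : ℝ, f (x + d) = f' (x + d) :=
    (measurePreserving_add_right (volume : Measure ℝ) d).quasiMeasurePreserving.ae hf
  filter_upwards [hf, hf₂, hshift 1, hshift (-1)] with x h h₂ hr hl
  rw [opB, opB, h, h₂, hr, hl]

theorem opB_coe_ae_eq (c : ℝ) (f f₂ : ℝ →ₘ[volume] ℂ) :
    opB c f f₂ =ᵐ[volume] ((c : ℂ) ^ 2 • f₂ + (2 : ℂ) • f + shift 1 f + shift (-1) f :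
      ℝ →ₘ[volume] ℂ) := by
  filter_upwards [shift_coe 1 f, shift_coe (-1) f, AEEqFun.coeFn_smul ((c : ℂ) ^ 2) f₂,
    AEEqFun.coeFn_smul (2 : ℂ) f,
    AEEqFun.coeFn_add ((c : ℂ) ^ 2 • f₂ + (2 : ℂ) • f + shift 1 f) (shift (-1) f),
    AEEqFun.coeFn_add ((c : ℂ) ^ 2 • f₂ + (2 : ℂ) • f) (shift 1 f),
    AEEqFun.coeFn_add ((c : ℂ) ^ 2 • f₂) ((2 : ℂ) • f)] with x hr hl hsmul₂ hsmul hadd hadd' hadd''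
  simp only [hadd, hadd', hadd'', hsmul, hsmul₂, hr, hl, Pi.add_apply, Pi.smul_apply, smul_eq_mul,
    opB]

theorem isBImage_iff {f g : ℝ →ₘ[volume] ℂ} :
    IsBImage c f g ↔ ∃ f₂ : ℝ → ℂ, IsWeakDeriv 2 f f₂ ∧ g =ᵐ[volume] opB c f f₂ := by
  constructor
  · rintro ⟨f₂, hf₂, rfl⟩
    exact ⟨f₂, hf₂, (opB_coe_ae_eq c f f₂).symm⟩
  · rintro ⟨f₂, hf₂, hg⟩
    have hmk := AEEqFun.coeFn_mk f₂ hf₂.2.1.aestronglyMeasurable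
    refine ⟨AEEqFun.mk f₂ _, hf₂.congr .rfl hmk.symm, AEEqFun.ext (hg.trans ?_)⟩
    exact (opB_congr_ae c .rfl hmk.symm).trans (opB_coe_ae_eq c f _)

theorem shift_add (d : ℝ) (f g : ℝ →ₘ[volume] ℂ) : shift d (f + g) = shift d f + shift d g :=
  AEEqFun.induction_on₂ f g fun _ _ _ _ => rfl

theorem shift_smul (d : ℝ) (a : ℂ) (f : ℝ →ₘ[volume] ℂ) : shift d (a • f) = a • shift d f :=
  AEEqFun.induction_on f fun _ _ => rfl

theorem IsBImage.add {f g f' g' : ℝ →ₘ[volume] ℂ} (h : IsBImage c f g) (h' : IsBImage c f' g') :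
    IsBImage c (f + f') (g + g') := by
  obtain ⟨f₂, hf₂, rfl⟩ := h
  obtain ⟨f₂', hf₂', rfl⟩ := h'
  refine ⟨f₂ + f₂', (hf₂.add hf₂').congr (AEEqFun.coeFn_add f f').symm
    (AEEqFun.coeFn_add f₂ f₂').symm, ?_⟩
  rw [shift_add, shift_add, smul_add, smul_add]
  abel

theorem IsBImage.smul {f g : ℝ →ₘ[volume] ℂ} (h : IsBImage c f g) (a : ℂ) :
    IsBImage c (a • f) (a • g) := by
  obtain ⟨f₂, hf₂, rfl⟩ := h
  refine ⟨a • f₂, (hf₂.const_smul a).congr (AEEqFun.coeFn_smul a f).symm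
    (AEEqFun.coeFn_smul a f₂).symm, ?_⟩
  rw [shift_smul, shift_smul, smul_add, smul_add, smul_add, smul_comm a, smul_comm a (2 : ℂ)]

theorem IsBImage.unique {f g g' : ℝ →ₘ[volume] ℂ} (h : IsBImage c f g) (h' : IsBImage c f g') :
    g = g' := by
  obtain ⟨f₂, hf₂, rfl⟩ := h
  obtain ⟨f₂', hf₂', rfl⟩ := h'
  rw [AEEqFun.ext (hf₂.unique hf₂')]

theorem norm_ofReal_sq (c : ℝ) : ‖(c : ℂ) ^ 2‖ = c ^ 2 := by
  rw [norm_pow, Complex.norm_real, Real.norm_eq_abs, sq_abs]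

theorem ExpBdd.two_mul_add_shifts (hq : |q| ≤ 1) (hf : ExpBdd q M f) :
    ExpBdd q (8 * M) fun x => 2 * f x + f (x + 1) + f (x + -1) := by
  refine ExpBdd.mono (((hf.const_smul 2).add (hf.comp_add_right 1)).add (hf.comp_add_right (-1))) ?_
  have hr : Real.exp (q * 1) ≤ 3 := exp_le_three (by linarith [(abs_le.1 hq).2])
  have hl : Real.exp (q * -1) ≤ 3 := exp_le_three (by linarith [(abs_le.1 hq).1])
  rw [Complex.norm_two]
  nlinarith [hf.nonneg]

theorem ExpBdd.opB {M₂ : ℝ} (c : ℝ) (hq : |q| ≤ 1) (hf : ExpBdd q M f) (hf₂ : ExpBdd q M₂ f₂) :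
    ExpBdd q (c ^ 2 * M₂ + 8 * M) (opB c f f₂) := by
  have hsum := (hf₂.const_smul ((c : ℂ) ^ 2)).add (hf.two_mul_add_shifts hq)
  rw [norm_ofReal_sq] at hsum
  refine hsum.congr (Eventually.of_forall fun x => ?_)
  simp only [AdvanceDelay.opB, Pi.add_apply, Pi.smul_apply, smul_eq_mul]
  ring

theorem ExpBdd.exists_opB_eq (hc : 1 ≤ c) (hq : |q| ≤ 1) (hf : ExpBdd q M f)
    (hg : ExpBdd q M g) : ∃ f₂, AdvanceDelay.opB c f f₂ = g ∧ ExpBdd q (9 * M) f₂ := by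
  have hc0 : (c : ℂ) ^ 2 ≠ 0 := pow_ne_zero 2 (Complex.ofReal_ne_zero.2 (by linarith))
  have hcinv : ‖((c : ℂ) ^ 2)⁻¹‖ ≤ 1 := by
    rw [norm_inv, norm_ofReal_sq]
    exact inv_le_one_of_one_le₀ (one_le_pow₀ hc)
  refine ⟨_, ?_, ((hg.add ((hf.two_mul_add_shifts hq).const_smul (-1))).const_smul
    ((c : ℂ) ^ 2)⁻¹).mono ?_⟩
  · ext x
    simp only [AdvanceDelay.opB, Pi.add_apply, Pi.smul_apply, smul_eq_mul]
    rw [mul_inv_cancel_left₀ hc0]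
    ring
  · rw [norm_neg, norm_one]
    nlinarith [mul_le_mul_of_nonneg_right hcinv hf.nonneg]

theorem exists_isBImage (c : ℝ) (hq : |q| ≤ 1) (f : WInf q 2) :
    ∃ g : LInf q, IsBImage c f g ∧ ‖g‖ ≤ (4 * c ^ 2 + 8) * ‖f‖ := by
  obtain ⟨f₁, f₂, hd₁, hd₂, -, hf₂⟩ := exists_isWeakDeriv_expBdd hq f
  have hg := ((expBdd_coe f).opB c hq hf₂).mono
    (by linarith : _ ≤ (4 * c ^ 2 + 8) * ‖f‖)
  have hmk := AEEqFun.coeFn_mk _ hg.1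
  have hg' := hg.congr hmk.symm
  exact ⟨⟨AEEqFun.mk _ hg.1, mem_LInf hg'⟩, isBImage_iff.2 ⟨f₂, hd₁.trans hd₂, hmk⟩,
    norm_LInf_le _ hg'⟩

theorem kerBdd_green (hc : 1 ≤ c) (hc' : c ^ 2 ≤ 25 / 24) (hq : |q| ≤ 1 / 8) (h0 : q ≠ 0) :
    KerBdd q |q| 21000 (green c q) :=
  ⟨measurable_green hc (by linarith) h0, norm_green_le_exp hc hc' hq h0⟩

theorem exists_WInf_two_of_integral_opB (hc : 1 ≤ c) (hq : |q| ≤ 1) (hf : ExpBdd q M f)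
    (g : LInf q) (hgM : ‖g‖ ≤ M)
    (h : ∀ φ, IsTestFun φ → ∫ x, opB c φ (deriv (deriv φ)) x * f x = ∫ x, φ x * g.1 x) :
    ∃ F : WInf q 2, F.1 =ᵐ[volume] f ∧ IsBImage c F g ∧ ‖F‖ ≤ 1026 * M := by
  obtain ⟨f₂, hf₂_eq, hf₂⟩ := hf.exists_opB_eq hc hq ((expBdd_coe g).mono hgM)
  rw [← hf₂_eq] at h
  have hd₂ := isWeakDeriv_two_of_integral_opB (by linarith) hf.locallyIntegrable
    hf₂.locallyIntegrable h
  have hmk := AEEqFun.coeFn_mk f hf.1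
  have hd₂' := hd₂.congr hmk.symm .rfl
  have hf' := hf.congr hmk.symm
  obtain ⟨f₁, hd₁, hf₁⟩ := hd₂'.exists_one hq hf' hf₂
  have hmem := mem_WInf_two hq hf' hf₁ hf₂ hd₁ (hd₁.of_two hd₂')
  refine ⟨⟨AEEqFun.mk f hf.1, hmem⟩, hmk, isBImage_iff.2 ⟨f₂, hd₂', ?_⟩,
    (norm_WInf_two_le hq ⟨_, hmem⟩ hf' hf₁ hf₂ hd₁ (hd₁.of_two hd₂')).trans_eq (by ring)⟩
  exact .trans (by rw [hf₂_eq]) (opB_congr_ae c hmk.symm .rfl)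

theorem convK_green_neg_opB (hc : 1 ≤ c) (hq : |q| ≤ 1 / 4) (h0 : q ≠ 0) (hφ : IsTestFun φ) :
    convK (fun y => green c q (-y)) (opB c φ (deriv (deriv φ))) = φ := by
  simp only [fun y => (green_neg c q (-y)).symm, neg_neg]
  exact convK_green_opB hc (by rwa [abs_neg]) (neg_ne_zero.2 h0) hφ

theorem integral_opB_mul_convK_green (hc : 1 ≤ c) (hc' : c ^ 2 ≤ 25 / 24) (hq : |q| ≤ 1 / 8)
    (h0 : q ≠ 0) (hg : ExpBdd q M g) (hφ : IsTestFun φ) :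
    ∫ x, opB c φ (deriv (deriv φ)) x * convK (green c q) g x = ∫ x, φ x * g x := by
  rw [(kerBdd_green hc hc' hq h0).integral_mul_convK (abs_pos.2 h0) hg (isTestFun_opB c hφ),
    convK_green_neg_opB hc (by linarith) h0 hφ]

theorem exists_solution (hc : 1 ≤ c) (hc' : c ^ 2 ≤ 25 / 24) (hq : |q| ≤ 1 / 8) (h0 : q ≠ 0)
    (g : LInf q) :
    ∃ f : WInf q 2, f.1 =ᵐ[volume] convK (green c q) g ∧ IsBImage c f g ∧
      ‖f‖ ≤ 1026 * (21000 * ‖g‖ * (2 / |q|)) := by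
  have hq0 : 0 < |q| := abs_pos.2 h0
  have hq1 : |q| ≤ 1 := by linarith
  refine exists_WInf_two_of_integral_opB hc hq1
    ((kerBdd_green hc hc' hq h0).expBdd_convK hq0 (expBdd_coe g)) g ?_
    fun φ hφ => integral_opB_mul_convK_green hc hc' hq h0 (expBdd_coe g) hφ
  have hinv : 1 ≤ 2 / |q| := by rw [one_le_div hq0]; linarith
  nlinarith [norm_nonneg g]

end Equation

/-! ### Uniqueness -/

section Uniqueness

variable {c q : ℝ} {u v ψ φ : ℝ → ℂ}

theorem exists_isTestFun_eq_one_at_zero : ∃ η : ℝ → ℂ, IsTestFun η ∧ η 0 = 1 := by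
  let β : ContDiffBump (0 : ℝ) := ⟨1, 2, one_pos, one_lt_two⟩
  refine ⟨fun x => (β x : ℂ), isTestFun_ofReal β.contDiff β.hasCompactSupport, ?_⟩
  exact congrArg _ (β.one_of_mem_closedBall (Metric.mem_closedBall_self β.rIn_pos.le))

theorem exists_cutoff : ∃ (C : ℝ) (χ : ℕ → ℝ → ℂ), (∀ n, IsTestFun (χ n)) ∧
    (∀ n x, ‖χ n x‖ ≤ C ∧ ‖deriv (χ n) x‖ ≤ C) ∧
    ∀ x, Tendsto (χ · x) atTop (𝓝 1) ∧ Tendsto (fun n => deriv (χ n) x) atTop (𝓝 0) := by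
  obtain ⟨η, hη, hη0⟩ := exists_isTestFun_eq_one_at_zero
  obtain ⟨C₀, hC₀⟩ := hη.continuous.bounded_above_of_compact_support hη.hasCompactSupport
  obtain ⟨C₁, hC₁⟩ :=
    hη.deriv.continuous.bounded_above_of_compact_support hη.deriv.hasCompactSupport
  set a : ℕ → ℝ := fun n => 1 / ((n : ℝ) + 1)
  have ha : Tendsto a atTop (𝓝 0) := tendsto_one_div_add_atTop_nhds_zero_nat
  have ha0 (n : ℕ) : 0 < a n := Nat.one_div_pos_of_nat
  have ha1 (n : ℕ) : a n ≤ 1 := by simpa [a] using inv_le_one_of_one_le₀ (by simp)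
  have hderiv (n : ℕ) (x : ℝ) : deriv (fun x => η (a n * x)) x = a n * deriv η (a n * x) := by
    rw [deriv_comp_mul_left, Complex.real_smul]
  refine ⟨max C₀ C₁, fun n x => η (a n * x), fun n => ⟨hη.contDiff.comp (by fun_prop),
    hη.hasCompactSupport.comp_homeomorph (Homeomorph.mulLeft₀ (a n) (ha0 n).ne')⟩,
    fun n x => ⟨(hC₀ _).trans (le_max_left _ _), ?_⟩, fun x => ⟨?_, ?_⟩⟩
  · rw [hderiv, norm_mul, Complex.norm_real, Real.norm_of_nonneg (ha0 n).le]
    exact (mul_le_of_le_one_left (norm_nonneg _) (ha1 n)).trans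
      ((hC₁ _).trans (le_max_right _ _))
  · have hcont : Continuous fun b : ℝ => η (b * x) := hη.continuous.comp (by fun_prop)
    exact (hcont.tendsto' 0 1 (by simpa using hη0)).comp ha
  · have hη' := hη.deriv.continuous
    have hcont : Continuous fun b : ℝ => (b : ℂ) * deriv η (b * x) := by fun_prop
    simp only [hderiv]
    exact (hcont.tendsto' 0 0 (by simp)).comp ha

theorem tendsto_integral_mul_of_norm_le {χ : ℕ → ℝ → ℂ} {C : ℝ} {l : ℂ} (hv : Integrable v)
    (hχ : ∀ n, Continuous (χ n)) (hC : ∀ n x, ‖χ n x‖ ≤ C)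
    (hl : ∀ x, Tendsto (χ · x) atTop (𝓝 l)) :
    Tendsto (fun n => ∫ x, χ n x * v x) atTop (𝓝 (l * ∫ x, v x)) := by
  rw [← integral_const_mul]
  refine tendsto_integral_of_dominated_convergence (fun x => C * ‖v x‖)
    (fun n => (hχ n).aestronglyMeasurable.mul hv.1) (hv.norm.const_mul C)
    (fun n => Eventually.of_forall fun x => ?_)
    (Eventually.of_forall fun x => (hl x).mul_const (v x))
  rw [norm_mul]
  exact mul_le_mul_of_nonneg_right (hC n x) (norm_nonneg _)

theorem IsWeakDeriv.integral_deriv_mul_of_integrable (h : IsWeakDeriv 1 u v)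
    (hψ : ContDiff ℝ ∞ ψ) (hψu : Integrable fun x => ψ x * u x)
    (hψ'u : Integrable fun x => deriv ψ x * u x) (hψv : Integrable fun x => ψ x * v x) :
    ∫ x, deriv ψ x * u x = -∫ x, ψ x * v x := by
  obtain ⟨C, χ, hχ, hC, hlim⟩ := exists_cutoff
  have hcutoff (n : ℕ) : (∫ x, deriv (χ n) x * (ψ x * u x)) + ∫ x, χ n x * (deriv ψ x * u x) =
      -∫ x, χ n x * (ψ x * v x) := by
    have hi {η w : ℝ → ℂ} (hη : IsTestFun η) (hw : Integrable w) :
        Integrable fun x => η x * w x := hη.integrable_mul hw.locallyIntegrable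
    rw [← integral_add (hi (hχ n).deriv hψu) (hi (hχ n) hψ'u)]
    convert (isWeakDeriv_one_iff.1 h).2.2 _ ((hχ n).mul_contDiff hψ) using 3 with x
    · rw [((hasDerivAt_of_contDiff (hχ n).contDiff x).fun_mul (hasDerivAt_of_contDiff hψ x)).deriv]
      ring
    · exact (mul_assoc _ _ _).symm
  have hχ_cont (n : ℕ) : Continuous (χ n) := (hχ n).continuous
  have hleft := (tendsto_integral_mul_of_norm_le hψu (fun n => (hχ n).deriv.continuous)
    (fun n x => (hC n x).2) fun x => (hlim x).2).add
    (tendsto_integral_mul_of_norm_le hψ'u hχ_cont (fun n x => (hC n x).1) fun x => (hlim x).1)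
  have hright := (tendsto_integral_mul_of_norm_le hψv hχ_cont (fun n x => (hC n x).1)
    fun x => (hlim x).1).neg
  simp only [hcutoff, zero_mul, one_mul, zero_add] at hleft hright
  exact tendsto_nhds_unique hleft hright

/-- The decay of `K` lets `B_c` be moved onto `convK (fun y => K (-y)) φ`, which need not be
compactly supported. -/
theorem KerBdd.integral_convK_neg_mul_opB {m A M M₁ M₂ : ℝ} {K f f₁ f₂ : ℝ → ℂ}
    (hK : KerBdd q m A K) (hm : 0 < m) (c : ℝ) (hd₁ : IsWeakDeriv 1 f f₁)
    (hd₂ : IsWeakDeriv 1 f₁ f₂) (hf : ExpBdd q M f) (hf₁ : ExpBdd q M₁ f₁)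
    (hf₂ : ExpBdd q M₂ f₂) (hφ : IsTestFun φ) :
    ∫ x, convK (fun y => K (-y)) φ x * opB c f f₂ x =
      ∫ x, convK (fun y => K (-y)) (opB c φ (deriv (deriv φ))) x * f x := by
  have hK' := hK.comp_neg.locallyIntegrable
  set ψ := convK (fun y => K (-y)) φ
  have hψ : ContDiff ℝ ∞ ψ := contDiff_convK hK' hφ
  have hψ' : deriv ψ = convK (fun y => K (-y)) (deriv φ) := deriv_convK hK' hφ
  have hψ'' : deriv (deriv ψ) = convK (fun y => K (-y)) (deriv (deriv φ)) := by
    rw [hψ', deriv_convK hK' hφ.deriv]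
  have hint {η h : ℝ → ℂ} {N : ℝ} (hη : IsTestFun η) (hh : ExpBdd q N h) :
      Integrable fun x => convK (fun y => K (-y)) η x * h x :=
    hK.integrable_convK_neg_mul hm hh hη
  have hshift (d : ℝ) : Integrable fun x => ψ (x + d) * f x := by
    simpa only [convK_comp_add] using hint (hφ.comp_add_right d) hf
  have hψ''f : ∫ x, deriv (deriv ψ) x * f x = -∫ x, deriv ψ x * f₁ x := by
    refine hd₁.integral_deriv_mul_of_integrable (contDiff_deriv hψ) ?_ ?_ ?_
    · simpa only [hψ'] using hint hφ.deriv hf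
    · simpa only [hψ''] using hint hφ.deriv.deriv hf
    · simpa only [hψ'] using hint hφ.deriv hf₁
  have hψ'f₁ : ∫ x, deriv ψ x * f₁ x = -∫ x, ψ x * f₂ x := by
    refine hd₂.integral_deriv_mul_of_integrable hψ (hint hφ hf₁) ?_ (hint hφ hf₂)
    simpa only [hψ'] using hint hφ.deriv hf₁
  have hsub := integral_opB_mul_sub (ψ := ψ) (ψ₂ := deriv (deriv ψ)) c
    (by simpa only [hψ''] using hint hφ.deriv.deriv hf)
    (hint hφ hf) (hshift 1) (hshift (-1)) (hint hφ hf₂)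
  rw [hψ''f, hψ'f₁, neg_neg, sub_self, mul_zero, hψ'', opB_convK c hK' hφ] at hsub
  exact (sub_eq_zero.1 hsub).symm

theorem IsBImage.ae_eq_convK_green (hc : 1 ≤ c) (hc' : c ^ 2 ≤ 25 / 24) (hq : |q| ≤ 1 / 8)
    (h0 : q ≠ 0) {f : WInf q 2} {g : LInf q} (h : IsBImage c f g) :
    f.1 =ᵐ[volume] convK (green c q) g := by
  have hq0 : 0 < |q| := abs_pos.2 h0
  have hK := kerBdd_green hc hc' hq h0
  obtain ⟨f₁, f₂, hd₁, hd₂, hf₁, hf₂⟩ := exists_isWeakDeriv_expBdd (by linarith) f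
  obtain ⟨f₂', hd₂', hg⟩ := isBImage_iff.1 h
  have hg' : g.1 =ᵐ[volume] opB c f f₂ :=
    hg.trans (opB_congr_ae c .rfl (hd₂'.unique (hd₁.trans hd₂)))
  refine ae_eq_of_integral_testFun_mul_eq (expBdd_coe f).locallyIntegrable
    (hK.expBdd_convK hq0 (expBdd_coe g)).locallyIntegrable fun φ hφ => ?_
  calc ∫ x, φ x * f.1 x
      = ∫ x, convK (fun y => green c q (-y)) φ x * opB c f f₂ x := by
        rw [hK.integral_convK_neg_mul_opB hq0 c hd₁ hd₂ (expBdd_coe f) hf₁ hf₂ hφ,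
          convK_green_neg_opB hc (by linarith) h0 hφ]
    _ = ∫ x, convK (fun y => green c q (-y)) φ x * g.1 x :=
        integral_congr_ae (hg'.mono fun x hx => by simp only [hx])
    _ = ∫ x, φ x * convK (green c q) g x :=
        (hK.integral_mul_convK hq0 (expBdd_coe g) hφ).symm

end Uniqueness

/-! ### The Laplace contour formula -/

section LaplaceInversion

variable {c q M σ δ : ℝ} {g : ℝ → ℂ}

theorem kernelK_mul_exp (c x s : ℝ) (z : ℂ) :
    kernelK c x z * Complex.exp (-(s * z)) = kernelK c (x - s) z := by
  rw [kernelK, kernelK, div_mul_eq_mul_div, ← Complex.exp_add]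
  congr 2
  push_cast
  ring

theorem integrable_prod_kernelK_mul (hc : 1 ≤ c) (hσ : |σ| ≤ 1 / 4) (h0 : σ ≠ 0) (hqσ : q < σ)
    (hg : ExpBdd q M g) (x : ℝ) :
    Integrable (fun p : ℝ × ℝ => kernelK c (x - p.2) (vline σ p.1) * g p.2)
      (volume.prod (volume.restrict (Set.Ioi 0))) := by
  have hexp : IntegrableOn (fun s : ℝ => M * Real.exp ((q - σ) * s)) (Set.Ioi 0) :=
    (integrableOn_exp_mul_Ioi (sub_neg.2 hqσ) 0).const_mul M
  refine ((integrable_const_div_one_add_sq (400 / |σ| * Real.exp (x * σ))).mul_prod hexp).mono'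
    ?_ ?_
  · have hkernel := (continuous_kernelK_vline hc hσ h0).comp
      (by fun_prop : Continuous fun p : ℝ × ℝ => (x - p.2, p.1))
    exact hkernel.aestronglyMeasurable.mul hg.1.restrict.comp_snd
  · filter_upwards [Measure.quasiMeasurePreserving_snd.ae (ae_restrict_of_ae hg.2)] with p hp
    calc ‖kernelK c (x - p.2) (vline σ p.1) * g p.2‖
        ≤ 400 / |σ| * Real.exp ((x - p.2) * σ) / (1 + p.1 ^ 2) * (M * Real.exp (q * p.2)) := by
          rw [norm_mul]
          gcongr
          exact norm_kernelK_vline_le hc hσ h0 _ _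
      _ = 400 / |σ| * Real.exp (x * σ) / (1 + p.1 ^ 2) * (M * Real.exp ((q - σ) * p.2)) := by
          rw [sub_mul, sub_mul, sub_eq_add_neg, sub_eq_add_neg, Real.exp_add, Real.exp_add]
          ring_nf

theorem kernelK_mul_laplacePlus (c x : ℝ) (g : ℝ → ℂ) (z : ℂ) :
    kernelK c x z * laplacePlus g z = ∫ s in Set.Ioi (0 : ℝ), kernelK c (x - s) z * g s := by
  rw [laplacePlus, ← integral_const_mul]
  simp only [← kernelK_mul_exp, mul_right_comm _ (Complex.exp _), mul_assoc]

theorem integrable_kernelK_mul_laplacePlus (hc : 1 ≤ c) (hσ : |σ| ≤ 1 / 4) (h0 : σ ≠ 0)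
    (hqσ : q < σ) (hg : ExpBdd q M g) (x : ℝ) :
    Integrable fun t => kernelK c x (vline σ t) * laplacePlus g (vline σ t) := by
  simpa only [kernelK_mul_laplacePlus] using
    (integrable_prod_kernelK_mul hc hσ h0 hqσ hg x).integral_prod_left

theorem contourIntegral_kernelK_mul_laplacePlus (hc : 1 ≤ c) (hσ : |σ| ≤ 1 / 4) (h0 : σ ≠ 0)
    (hqσ : q < σ) (hg : ExpBdd q M g) (x : ℝ) :
    contourIntegral σ (fun z => kernelK c x z * laplacePlus g z) =
      ∫ s in Set.Ioi (0 : ℝ), green c σ (x - s) * g s := by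
  simp only [green, contourIntegral_eq, kernelK_mul_laplacePlus]
  rw [integral_integral_swap (integrable_prod_kernelK_mul hc hσ h0 hqσ hg x),
    ← integral_const_mul]
  simp only [integral_mul_const, mul_assoc]

theorem laplaceMinus_eq (g : ℝ → ℂ) (z : ℂ) :
    laplaceMinus g z = laplacePlus (fun s => g (-s)) (-z) := by
  simp only [laplaceMinus, laplacePlus, mul_neg, neg_neg]

theorem ExpBdd.comp_neg (hg : ExpBdd q M g) : ExpBdd (-q) M fun s => g (-s) := by
  have hneg := (Measure.measurePreserving_neg (volume : Measure ℝ)).quasiMeasurePreserving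
  refine ⟨hg.1.comp_quasiMeasurePreserving hneg, ?_⟩
  filter_upwards [hneg.ae hg.2] with s hs
  rwa [neg_mul_comm]

theorem kernelK_mul_laplaceMinus (c x : ℝ) (g : ℝ → ℂ) (z : ℂ) :
    kernelK c x z * laplaceMinus g z =
      kernelK c (-x) (-z) * laplacePlus (fun s => g (-s)) (-z) := by
  rw [laplaceMinus_eq, kernelK_neg]

theorem integrable_kernelK_mul_laplaceMinus (hc : 1 ≤ c) (hσ : |σ| ≤ 1 / 4) (h0 : σ ≠ 0)
    (hqσ : σ < q) (hg : ExpBdd q M g) (x : ℝ) :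
    Integrable fun t => kernelK c x (vline σ t) * laplaceMinus g (vline σ t) := by
  simpa only [kernelK_mul_laplaceMinus, neg_vline] using (integrable_kernelK_mul_laplacePlus hc
    (by rwa [abs_neg]) (neg_ne_zero.2 h0) (neg_lt_neg hqσ) hg.comp_neg (-x)).comp_neg

theorem contourIntegral_kernelK_mul_laplaceMinus (hc : 1 ≤ c) (hσ : |σ| ≤ 1 / 4) (h0 : σ ≠ 0)
    (hqσ : σ < q) (hg : ExpBdd q M g) (x : ℝ) :
    contourIntegral σ (fun z => kernelK c x z * laplaceMinus g z) =
      ∫ s in Set.Iic (0 : ℝ), green c σ (x - s) * g s := by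
  simp only [kernelK_mul_laplaceMinus]
  rw [contourIntegral_comp_neg σ fun z => kernelK c (-x) z * laplacePlus (fun s => g (-s)) z,
    contourIntegral_kernelK_mul_laplacePlus hc (by rwa [abs_neg]) (neg_ne_zero.2 h0)
      (neg_lt_neg hqσ) hg.comp_neg]
  simpa only [← green_neg c σ, sub_neg_eq_add, neg_add', neg_zero] using
    integral_comp_neg_Ioi 0 fun s => green c σ (x - s) * g s

theorem abs_le_quarter_of_abs_sub_lt (hq : |q| ≤ 1 / 8) (h : |σ - q| < |q|) :
    |σ| ≤ 1 / 4 := by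
  linarith [abs_sub_abs_le_abs_sub σ q]

theorem ne_zero_of_abs_sub_lt (h : |σ - q| < |q|) : σ ≠ 0 := by
  rintro rfl
  simp at h

theorem green_eq_of_abs_sub_lt (hc : 1 ≤ c) (hq : |q| ≤ 1 / 8) (h : |σ - q| < |q|) :
    green c σ = green c q := by
  funext y
  have hσ := abs_le.1 (abs_le_quarter_of_abs_sub_lt hq h)
  have hq' := abs_le.1 hq
  have h' := abs_lt.1 h
  rcases lt_or_ge q 0 with hneg | hpos
  · rw [abs_of_neg hneg] at h'
    rcases le_total σ q with hle | hle
    · exact green_eq_of_neg hc hσ.1 hle hneg y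
    · exact (green_eq_of_neg hc (by linarith) hle (by linarith) y).symm
  · rw [abs_of_nonneg hpos] at h'
    rcases le_total σ q with hle | hle
    · exact green_eq_of_pos hc (by linarith) hle (by linarith) y
    · exact (green_eq_of_pos hc (by linarith) hle hσ.2 y).symm

theorem abs_add_sub_lt (hδ : 0 < δ) (hδq : δ < |q|) : |q + δ - q| < |q| := by
  rwa [add_sub_cancel_left, abs_of_pos hδ]

theorem abs_sub_sub_lt (hδ : 0 < δ) (hδq : δ < |q|) : |q - δ - q| < |q| := by
  rwa [sub_sub_cancel_left, abs_neg, abs_of_pos hδ]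

theorem integrable_laplace (hc : 1 ≤ c) (hq : |q| ≤ 1 / 8) (hδ : 0 < δ) (hδq : δ < |q|)
    (hg : ExpBdd q M g) (x : ℝ) :
    Integrable (fun t => kernelK c x (vline (q + δ) t) * laplacePlus g (vline (q + δ) t)) ∧
      Integrable (fun t => kernelK c x (vline (q - δ) t) * laplaceMinus g (vline (q - δ) t)) :=
  have hplus := abs_add_sub_lt hδ hδq
  have hminus := abs_sub_sub_lt hδ hδq
  ⟨integrable_kernelK_mul_laplacePlus hc (abs_le_quarter_of_abs_sub_lt hq hplus)
    (ne_zero_of_abs_sub_lt hplus) (lt_add_of_pos_right q hδ) hg x,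
  integrable_kernelK_mul_laplaceMinus hc (abs_le_quarter_of_abs_sub_lt hq hminus)
    (ne_zero_of_abs_sub_lt hminus) (sub_lt_self q hδ) hg x⟩

theorem contourIntegral_add_contourIntegral (hc : 1 ≤ c) (hc' : c ^ 2 ≤ 25 / 24)
    (hq : |q| ≤ 1 / 8) (hδ : 0 < δ) (hδq : δ < |q|) (hg : ExpBdd q M g) (x : ℝ) :
    contourIntegral (q + δ) (fun z => kernelK c x z * laplacePlus g z) +
      contourIntegral (q - δ) (fun z => kernelK c x z * laplaceMinus g z) =
    convK (green c q) g x := by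
  have hq0 : 0 < |q| := hδ.trans hδq
  have hplus := abs_add_sub_lt hδ hδq
  have hminus := abs_sub_sub_lt hδ hδq
  have hint := (kerBdd_green hc hc' hq (abs_pos.1 hq0)).integrable_conv hq0 hg x
  rw [contourIntegral_kernelK_mul_laplacePlus hc (abs_le_quarter_of_abs_sub_lt hq hplus)
      (ne_zero_of_abs_sub_lt hplus) (lt_add_of_pos_right q hδ) hg,
    contourIntegral_kernelK_mul_laplaceMinus hc (abs_le_quarter_of_abs_sub_lt hq hminus)
      (ne_zero_of_abs_sub_lt hminus) (sub_lt_self q hδ) hg,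
    green_eq_of_abs_sub_lt hc hq hplus, green_eq_of_abs_sub_lt hc hq hminus, add_comm,
    intervalIntegral.integral_Iic_add_Ioi hint.integrableOn hint.integrableOn, convK]

end LaplaceInversion

/-! ### The isomorphism -/

section Isomorphism

variable {c q : ℝ}

/-- `B_c` as a linear map from `W_q^{2,∞}` to `L_q^∞`; the image is chosen by existence and is
determined by `IsBImage.unique`. -/
def linB (c : ℝ) (hq : |q| ≤ 1) : WInf q 2 →ₗ[ℂ] LInf q where
  toFun f := (exists_isBImage c hq f).choose
  map_add' f g := Subtype.ext <| (exists_isBImage c hq (f + g)).choose_spec.1.unique <|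
    (exists_isBImage c hq f).choose_spec.1.add (exists_isBImage c hq g).choose_spec.1
  map_smul' a f := Subtype.ext <| (exists_isBImage c hq (a • f)).choose_spec.1.unique <|
    (exists_isBImage c hq f).choose_spec.1.smul a

theorem isBImage_linB (c : ℝ) (hq : |q| ≤ 1) (f : WInf q 2) : IsBImage c f (linB c hq f) :=
  (exists_isBImage c hq f).choose_spec.1

theorem norm_linB_le (c : ℝ) (hq : |q| ≤ 1) (f : WInf q 2) :
    ‖linB c hq f‖ ≤ (4 * c ^ 2 + 8) * ‖f‖ :=
  (exists_isBImage c hq f).choose_spec.2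

theorem linB_eq_iff {hq : |q| ≤ 1} {f : WInf q 2} {g : LInf q} :
    linB c hq f = g ↔ IsBImage c f g :=
  ⟨fun h => h ▸ isBImage_linB c hq f, fun h => Subtype.ext ((isBImage_linB c hq f).unique h)⟩

theorem linB_bijective (hc : 1 ≤ c) (hc' : c ^ 2 ≤ 25 / 24) (hq : |q| ≤ 1 / 8) (h0 : q ≠ 0)
    (hq1 : |q| ≤ 1) : Function.Bijective (linB c hq1) := by
  refine ⟨fun f f' h => Subtype.ext (AEEqFun.ext ?_), fun g => ?_⟩
  · exact ((linB_eq_iff.1 h).ae_eq_convK_green hc hc' hq h0).trans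
      ((isBImage_linB c hq1 f').ae_eq_convK_green hc hc' hq h0).symm
  · obtain ⟨f, -, hf, -⟩ := exists_solution hc hc' hq h0 g
    exact ⟨f, linB_eq_iff.2 hf⟩

theorem IsBImage.norm_le (hc : 1 ≤ c) (hc' : c ^ 2 ≤ 25 / 24) (hq : |q| ≤ 1 / 8) (h0 : q ≠ 0)
    {f : WInf q 2} {g : LInf q} (h : IsBImage c f g) : ‖f‖ ≤ 43092000 * |q|⁻¹ * ‖g‖ := by
  obtain ⟨f', hf', -, hle⟩ := exists_solution hc hc' hq h0 g
  obtain rfl : f = f' :=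
    Subtype.ext (AEEqFun.ext ((h.ae_eq_convK_green hc hc' hq h0).trans hf'.symm))
  exact hle.trans_eq (by ring)

theorem exists_continuousLinearEquiv (hc : 1 ≤ c) (hc' : c ^ 2 ≤ 25 / 24) (hq : |q| ≤ 1 / 8)
    (h0 : q ≠ 0) :
    ∃ B : WInf q 2 ≃L[ℂ] LInf q, (∀ f : WInf q 2, IsBImage c f (B f)) ∧
      ‖(B.symm : LInf q →L[ℂ] WInf q 2)‖ ≤ 43092000 * |q|⁻¹ := by
  have hq1 : |q| ≤ 1 := by linarith
  let e : WInf q 2 ≃ₗ[ℂ] LInf q :=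
    LinearEquiv.ofBijective (linB c hq1) (linB_bijective hc hc' hq h0 hq1)
  have hsymm (g : LInf q) : ‖e.symm g‖ ≤ 43092000 * |q|⁻¹ * ‖g‖ :=
    (linB_eq_iff (hq := hq1).1 (e.apply_symm_apply g)).norm_le hc hc' hq h0
  exact ⟨e.toContinuousLinearEquivOfBounds _ _ (norm_linB_le c hq1) hsymm, isBImage_linB c hq1,
    ContinuousLinearMap.opNorm_le_bound _ (by positivity) hsymm⟩

end Isomorphism

theorem one_le_waveSpeed (ε : ℝ) : 1 ≤ waveSpeed ε :=
  Real.one_le_sqrt.2 (le_add_of_nonneg_right (by positivity))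

theorem waveSpeed_sq_le {ε : ℝ} (h : |ε| ≤ 1) : waveSpeed ε ^ 2 ≤ 25 / 24 := by
  rw [waveSpeed, Real.sq_sqrt (by positivity)]
  linarith [(sq_le_one_iff_abs_le_one ε).2 h]

theorem rateB_pos {a qFP : ℝ} (ha : 0 < a) (hq : 0 < qFP) : 0 < rateB a qFP := by
  unfold rateB
  positivity

theorem rateB_le (a qFP : ℝ) : rateB a qFP ≤ 1 / 8 := min_le_left _ _

theorem epsB_le_one (a qFP εHWa : ℝ) : epsB a qFP εHWa ≤ 1 :=
  (min_le_right _ _).trans (min_le_right _ _)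

theorem proposition6p3_general : ∃ C : ℝ, 0 < C ∧ ∀ c q δ : ℝ, 1 ≤ c → c ^ 2 ≤ 25 / 24 →
    |q| ≤ 1 / 8 → 0 < δ → δ < |q| →
    ∃ B : WInf q 2 ≃L[ℂ] LInf q,
      (∀ f : WInf q 2, IsBImage c f (B f)) ∧
      (∀ (g : LInf q) (x : ℝ),
        Integrable (fun t : ℝ => kernelK c x (vline (q + δ) t) *
          laplacePlus g.1 (vline (q + δ) t)) ∧
        Integrable (fun t : ℝ => kernelK c x (vline (q - δ) t) *
          laplaceMinus g.1 (vline (q - δ) t))) ∧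
      (∀ g : LInf q, ∀ᵐ x : ℝ, (B.symm g).1 x =
        contourIntegral (q + δ) (fun z => kernelK c x z * laplacePlus g.1 z) +
        contourIntegral (q - δ) (fun z => kernelK c x z * laplaceMinus g.1 z)) ∧
      ‖(B.symm : LInf q →L[ℂ] WInf q 2)‖ ≤ C * |q|⁻¹ := by
  refine ⟨43092000, by norm_num, fun c q δ hc hc' hq hδ hδq => ?_⟩
  have h0 : q ≠ 0 := abs_pos.1 (hδ.trans hδq)
  obtain ⟨B, hB, hnorm⟩ := exists_continuousLinearEquiv hc hc' hq h0
  refine ⟨B, hB, fun g => integrable_laplace hc hq hδ hδq (expBdd_coe g), fun g => ?_, hnorm⟩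
  have hg : IsBImage c (B.symm g) g := by simpa only [B.apply_symm_apply] using hB (B.symm g)
  filter_upwards [hg.ae_eq_convK_green hc hc' hq h0] with x hx
  rw [hx, contourIntegral_add_contourIntegral hc hc' hq hδ hδq (expBdd_coe g)]

end AdvanceDelay

end

theorem proposition6p3 (a qFP εHWa : ℝ) (ha : 0 < a) (hqFP0 : 0 < qFP) (hqFP1 : qFP < 1)
    (hεHWa : 0 < εHWa) :
    ∃ C : ℝ, 0 < C ∧ ∀ ε : ℝ, 0 < ε → ε < epsB a qFP εHWa →
      ∀ q δ : ℝ, (q = -(rateB a qFP * ε) ∨ q = rateB a qFP * ε) →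
        δ = rateB a qFP * ε / 2 →
        -- `B` is an isomorphism from `W_q^{2,∞}` onto `L_q^∞`
        ∃ B : WInf q 2 ≃L[ℂ] LInf q,
          (∀ f : WInf q 2,
            IsBImage (waveSpeed ε) f (B f)) ∧
          -- the Laplace contour formula for its inverse, with absolutely convergent integrals
          (∀ (g : LInf q) (x : ℝ),
            Integrable (fun t : ℝ =>
              kernelK (waveSpeed ε) x (vline (q + δ) t) *
                laplacePlus g.1 (vline (q + δ) t)) ∧
            Integrable (fun t : ℝ =>
              kernelK (waveSpeed ε) x (vline (q - δ) t) *
                laplaceMinus g.1 (vline (q - δ) t))) ∧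
          (∀ g : LInf q, ∀ᵐ x : ℝ,
            (B.symm g).1 x =
              contourIntegral (q + δ) (fun z =>
                kernelK (waveSpeed ε) x z *
                  laplacePlus g.1 z) +
              contourIntegral (q - δ) (fun z =>
                kernelK (waveSpeed ε) x z *
                  laplaceMinus g.1 z)) ∧
          -- the operator norm of the inverse is at most `C / ε`
          ‖(B.symm : LInf q →L[ℂ] WInf q 2)‖ ≤ C * ε⁻¹ := by
  obtain ⟨C, hC, h⟩ := proposition6p3_general
  have hb := rateB_pos ha hqFP0
  refine ⟨C * (rateB a qFP)⁻¹, by positivity, fun ε hε hεB q δ hq hδ => ?_⟩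
  have hε1 : ε ≤ 1 := hεB.le.trans (epsB_le_one a qFP εHWa)
  have hqε : |q| = rateB a qFP * ε := by
    rw [(abs_eq_abs (b := rateB a qFP * ε)).2 hq.symm, abs_of_pos (by positivity)]
  have hq_le : rateB a qFP * ε ≤ 1 / 8 :=
    (mul_le_of_le_one_right hb.le hε1).trans (rateB_le a qFP)
  simpa only [hqε, mul_inv, mul_assoc] using h (waveSpeed ε) q δ (one_le_waveSpeed ε)
    (waveSpeed_sq_le ((abs_of_pos hε).trans_le hε1)) (hqε.trans_le hq_le) (hδ ▸ by positivity)
    (by rw [hqε, hδ]; exact half_lt_self (by positivity))
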